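/- Let $k\ge 2$, $I=[0,1]$, and let $\Sigma_k=\{0,\dots,k-1\}^{\mathbb Z}$ carry the left shift $\sigma$, the uniform Bernoulli measure $\nu$ (each symbol has probability $1/k$), and the metric $d(\omega,\omega')=2^{-\min\{|n|:\ \omega_n\ne\omega'_n\}}$. Let $\mathcal C(I)$ be the set of all continuous skew products $G(\omega,x)=(\sigma\omega,g_\omega(x))$ of $\Sigma_k\times I$ whose fiber maps $g_\omega$ are $C^2$ diffeomorphisms of $I$ onto their images in $I$ (each $g_\omega$ may depend on the whole sequence $\omega$), with the distance $\mathrm{dist}_{C^2}(F,G)=\sup_\omega \mathrm{dist}_{C^2}(f_\omega^{\pm1},g_\omega^{\pm1})$, where inverses are compared at the points at which both are defined. Call $G$ $C$-Lipschitz if $\mathrm{dist}_{C^2}(g_\omega,g_{\omega'})\le C\,d(\omega,\omega')$ for all $\omega,\omega'$. Put $A_{max}(G)=\bigcap_{n\ge0}G^n(\Sigma_k\times I)$ and $g^n_\omega=g_{\sigma^{n-1}\omega}\circ\dots\circ g_\omega$. **Theorem A.** There is $C_0>0$ such that for every $C\ge C_0$ there is a nonempty open set $\mathcal U\subset\mathcal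 C(I)$ and, for each $G\in\mathcal U$, a measurable set $\Omega_G\subset\Sigma_k$ with $\nu(\Omega_G)=1$, a function $\gamma_G:\Omega_G\to I$, continuous on $\Omega_G$, whose graph $\Gamma_G$ satisfies $G(\Gamma_G)=\Gamma_G$, and a Borel probability measure $\mu_G$ on $\Sigma_k\times I$, such that for every $G\in\mathcal U$: 1. if $G$ is $C$-Lipschitz, then either $\Omega_G=\Sigma_k$ and $A_{max}(G)=\Gamma_G$ (a continuous invariant graph), or $A_{max}(G)$ is a bony graph attractor, that is, the union of $\Gamma_G$ and of a nonempty family of nondegenerate vertical closed intervals $\{\omega\}\times[a,b]$, $\omega\notin\Omega_G$ (the bones), each contained in the closure of $\Gamma_G$; 2. $\mu_G$ is $G$-invariant and ergodic, projects to $\nu$, satisfies $\mu_G(\Gamma_G)=1$, and its support is the closure of $\Gamma_G$; $(G,\Gamma_G,\mu_G)$ is Bernoulli (isomorphic modulo null sets to a two-sided Bernoulli shift) and mixing; and $G\mapsto\mu_G$ is continuous on $\mathcal U$ from $\mathrm{dist}_{C^2}$ to the Hutchinson metric $d_H(\mu,\mu')=\sup|\int f\,d\mu-\int f\,d\mu'|$,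 the supremum being over the functions $f$ that are $1$-Lipschitz for the sum of $d$ and the distance in $I$; 3. the fiber Lyapunov exponent of $G$ is negative: there is $\lambda<0$ such that $\lim_{n\to\infty}\frac1n\log\sup_{x\ne x'}\frac{|g^n_\omega(x)-g^n_\omega(x')|}{|x-x'|}=\lambda$ for $\nu$-almost every $\omega$. Moreover, some $C$-Lipschitz $G\in\mathcal U$ has a bony graph attractor. -/

import Mathlib

open Set Filter Topology MeasureTheory
open scoped ENNReal unitInterval

noncomputable section

namespace BonyAttractor

/-! ### The two-sided Bernoulli shift -/

/-- The two-sided sequence space on `k` symbols, with its product topology and `σ`-algebra. -/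
abbrev Seq (k : ℕ) : Type := ℤ → Fin k

/-- The left shift `(shift ω)_n = ω_{n+1}` on two-sided sequences over any alphabet. -/
def shift {S : Type*} (ω : ℤ → S) : ℤ → S := fun n => ω (n + 1)

/-- The Bernoulli measure on `Seq k` for which all symbols have probability `1 / k`. -/
def bernoulliMeasure (k : ℕ) [NeZero k] : Measure (Seq k) :=
  Measure.infinitePi fun _ : ℤ => ProbabilityTheory.uniformOn (univ : Set (Fin k))

open Classical in
/-- The standard metric on sequences: `2 ^ (-m)`, where `m` is the least absolute value of an
index at which the two sequences differ. -/
def seqDist {k : ℕ} (ω ω' : Seq k) : ℝ :=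
  if ω = ω' then 0 else (1 / 2 : ℝ) ^ sInf {m : ℕ | ∃ n : ℤ, n.natAbs = m ∧ ω n ≠ ω' n}

/-! ### The space of random `C²` maps with fiber the unit interval -/

/-- A function on the unit interval, regarded as a function of a real variable (constant to the
left and to the right of the interval; only its values on `[0, 1]` matter below). -/
def lift (f : I → I) : ℝ → ℝ := fun x => (f (projIcc 0 1 zero_le_one x) : ℝ)

/-- `f` is a `C²` diffeomorphism of the unit interval onto its image in the unit interval
(orientation preserving or reversing; derivatives at the endpoints are one-sided). -/
structure IsC2Diffeo (f : I → I) : Prop where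
  injective : Function.Injective f
  contDiffOn : ContDiffOn ℝ 2 (lift f) (Icc 0 1)
  deriv_ne_zero : ∀ x ∈ Icc (0 : ℝ) 1, derivWithin (lift f) (Icc 0 1) x ≠ 0

/-- A random `C²` map over the Bernoulli shift: a continuous skew product
`(ω, x) ↦ (shift ω, fib ω x)` of `Seq k × I` whose fiber maps are `C²` diffeomorphisms onto
their images.  The fiber map `fib ω` may depend on the whole sequence `ω`. -/
structure RandomMap (k : ℕ) where
  fib : Seq k → I → I
  continuous_fib : Continuous fun z : Seq k × I => fib z.1 z.2
  diffeo : ∀ ω, IsC2Diffeo (fib ω)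

/-- The skew product itself. -/
def RandomMap.toMap {k : ℕ} (G : RandomMap k) : Seq k × I → Seq k × I :=
  fun z => (shift z.1, G.fib z.1 z.2)

/-- The inverse of an interval map, as a real function on the image of `[0, 1]`. -/
def liftInv (f : I → I) : ℝ → ℝ := Function.invFunOn (lift f) (Icc 0 1)

/-- The `C²` distance of two interval maps: the supremum over `[0, 1]` of the differences of
the values, of the first and of the second derivatives. -/
def c2Dist (f g : I → I) : ℝ≥0∞ :=
  ⨆ x ∈ Icc (0 : ℝ) 1, ⨆ j ∈ Iic (2 : ℕ), ENNReal.ofReal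
    |iteratedDerivWithin j (lift f) (Icc 0 1) x - iteratedDerivWithin j (lift g) (Icc 0 1) x|

/-- The `C²` distance of the inverses of two interval maps, over the points at which both
inverses are defined. -/
def c2DistInv (f g : I → I) : ℝ≥0∞ :=
  ⨆ y ∈ lift f '' Icc 0 1 ∩ lift g '' Icc 0 1, ⨆ j ∈ Iic (2 : ℕ), ENNReal.ofReal
    |iteratedDerivWithin j (liftInv f) (lift f '' Icc 0 1) y
      - iteratedDerivWithin j (liftInv g) (lift g '' Icc 0 1) y|

/-- The `C²` distance of random maps: the supremum over the base of the `C²` distances of the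
fiber maps and of their inverses. -/
def RandomMap.dist {k : ℕ} (F G : RandomMap k) : ℝ≥0∞ :=
  ⨆ ω : Seq k, max (c2Dist (F.fib ω) (G.fib ω)) (c2DistInv (F.fib ω) (G.fib ω))

/-- Openness of a set of random maps for the `C²` distance. -/
def IsOpenC2 {k : ℕ} (U : Set (RandomMap k)) : Prop :=
  ∀ F ∈ U, ∃ ε : ℝ≥0∞, 0 < ε ∧ ∀ G : RandomMap k, F.dist G < ε → G ∈ U

/-- The fiber maps depend on the base point in a Lipschitz way, with constant `C`, for the `C²`
distance. -/
def RandomMap.IsLipschitz {k : ℕ} (C : ℝ) (G : RandomMap k) : Prop :=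
  ∀ ω ω' : Seq k, c2Dist (G.fib ω) (G.fib ω') ≤ ENNReal.ofReal (C * seqDist ω ω')

/-! ### Attractors and graphs -/

/-- The maximal attractor: the intersection of the images of the iterates. -/
def RandomMap.maxAttractor {k : ℕ} (G : RandomMap k) : Set (Seq k × I) :=
  ⋂ n : ℕ, range (G.toMap^[n])

/-- The graph of (the restriction to `Ω` of) `γ`. -/
def graphOver {k : ℕ} (Ω : Set (Seq k)) (γ : Seq k → I) : Set (Seq k × I) :=
  {z | z.1 ∈ Ω ∧ z.2 = γ z.1}

/-- `Λ` is a continuous graph: the graph of a continuous function on the whole base. -/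
def IsContinuousGraph {k : ℕ} (Ω : Set (Seq k)) (γ : Seq k → I) (Λ : Set (Seq k × I)) : Prop :=
  Ω = univ ∧ Continuous γ ∧ Λ = graphOver Ω γ

/-- `Λ` is a bony graph: the union of the graph of a function `γ` that is continuous on a set
`Ω` of full measure, and of a nonempty family of bones: vertical nondegenerate closed intervals,
over base points outside `Ω`, each contained in the closure of the graph. -/
def IsBonyGraph {k : ℕ} [NeZero k] (Ω : Set (Seq k)) (γ : Seq k → I)
    (Λ : Set (Seq k × I)) : Prop :=
  (∀ᵐ ω ∂bernoulliMeasure k, ω ∈ Ω) ∧ ContinuousOn γ Ω ∧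
    ∃ bones : Set (Set (Seq k × I)), bones.Nonempty ∧
      (∀ B ∈ bones, (∃ ω ∉ Ω, ∃ a b : I, a < b ∧ B = {ω} ×ˢ Icc a b) ∧
        B ⊆ closure (graphOver Ω γ)) ∧
      Λ = graphOver Ω γ ∪ ⋃₀ bones

/-! ### Ergodic theory -/

/-- Strong mixing of a measure preserving map. -/
def IsMixing {X : Type*} [MeasurableSpace X] (T : X → X) (μ : Measure X) : Prop :=
  MeasurePreserving T μ μ ∧ ∀ A B : Set X, MeasurableSet A → MeasurableSet B →
    Tendsto (fun n : ℕ => μ (T^[n] ⁻¹' A ∩ B)) atTop (𝓝 (μ A * μ B))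

/-- `(T, μ)` is isomorphic modulo null sets to a two-sided Bernoulli shift, over some standard
Borel probability space as alphabet. -/
def IsBernoulli {X : Type*} [MeasurableSpace X] (T : X → X) (μ : Measure X) : Prop :=
  MeasurePreserving T μ μ ∧
    ∃ (S : Type) (_ : MeasurableSpace S) (_ : StandardBorelSpace S) (p : Measure S)
      (_ : IsProbabilityMeasure p) (φ : X → (ℤ → S)) (ψ : (ℤ → S) → X),
      MeasurePreserving φ μ (Measure.infinitePi fun _ : ℤ => p) ∧
      MeasurePreserving ψ (Measure.infinitePi fun _ : ℤ => p) μ ∧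
      (∀ᵐ x ∂μ, ψ (φ x) = x) ∧
      (∀ᵐ y ∂Measure.infinitePi fun _ : ℤ => p, φ (ψ y) = y) ∧
      (∀ᵐ x ∂μ, φ (T x) = shift (φ x))

/-- The Hutchinson distance of two measures on `Seq k × I`: the supremum of the differences of
the integrals of functions that are `1`-Lipschitz for the sum of the distances in the base and
in the fiber. -/
def hutchinsonDist {k : ℕ} (μ ν : Measure (Seq k × I)) : ℝ≥0∞ :=
  ⨆ f ∈ {f : Seq k × I → ℝ | ∀ y z, |f y - f z| ≤ seqDist y.1 z.1 + |(y.2 : ℝ) - z.2|},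
    ENNReal.ofReal |∫ z, f z ∂μ - ∫ z, f z ∂ν|

/-- The best Lipschitz constant of an interval map. -/
def lipNorm (f : I → I) : ℝ :=
  sSup {r : ℝ | ∃ x y : I, x ≠ y ∧ r = |(f x : ℝ) - f y| / |(x : ℝ) - y|}

/-- The `n`-th iterate along the fiber over `ω`, that is
`fib (shift^{n-1} ω) ∘ ⋯ ∘ fib (shift ω) ∘ fib ω`. -/
def RandomMap.fibIter {k : ℕ} (G : RandomMap k) (n : ℕ) (ω : Seq k) : I → I :=
  fun x => (G.toMap^[n] (ω, x)).2

/-- `lam` is the fiber Lyapunov exponent of `G`: for almost every `ω` the exponential growth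
rate of the Lipschitz constants of the fiber iterates over `ω` exists and equals `lam`. -/
def RandomMap.HasFiberExponent {k : ℕ} [NeZero k] (G : RandomMap k) (lam : ℝ) : Prop :=
  ∀ᵐ ω ∂bernoulliMeasure k,
    Tendsto (fun n : ℕ => Real.log (lipNorm (G.fibIter n ω)) / n) atTop (𝓝 lam)

end BonyAttractor

end

/-! All systems live near one step skew product `model`. Symbol `0` applies the decreasing map
`cubicMap`, weakly expanding around its fixed point 1/2 and contracting elsewhere; every other
symbol applies the contraction `affineMap`. Near the model the fiber Lipschitz constants are bounded
by numbers `nearLip` that depend on one symbol only. One of them exceeds 1, but their mean logarithm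
is negative.

By the ergodic theorem the products of these numbers along almost every past decay exponentially. A
fiber of the maximal attractor is a nested intersection of images of `I`, so almost every fiber is a
point (`LipBound.ae_mem_pointSet`). The set `pointSet` of base points with one-point fibers serves
as Ω, and closedness of the attractor makes the graph continuous there. The measure is the Bernoulli
measure lifted to the graph; the projection to the base is then an isomorphism with the shift, which
transports mixing and the Bernoulli property. Finitely many steps of the past determine the graph up
to an error of small mean and vary continuously with the map, whence Hutchinson continuity. Products
along almost every future are summable, so distortion over a whole fiber is bounded: the logarithm
of the best Lipschitz constant of the n-th fiber iterate is a Birkhoff sum of the log-derivative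
along the graph, up to O(1).

The hard point is that a nondegenerate fiber lies in the closure of the graph; this is a blender
argument (`IsBlender.exists_graph_between`). Pulling a piece of the fiber back along its own past
brings a nontrivial subinterval into the central region (`exists_preimages_central`). From then on
the past is free: at each step a symbol is chosen whose fiber map has preimages in [0.1, 0.9] and
contracts there, so pulling back lengthens the interval by at least 1/0.998. This must stop, and it
stops only when the interval straddles one of two landmarks, near 0.2 and 0.8135, through which the
graph passes over explicit pasts. Pushing forward places a graph point in the original piece. Since
fiber maps may depend on the entire sequence, changing the past moves preimages; the Lipschitz
condition and closeness to a step map keep the displacement below 0.003 (`exists_fibIter_eq_near`).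

For the model itself, the attracting 2-cycle of `cubicMap` gives a nondegenerate fiber over the
constant sequence `0`, so a bone exists. -/

noncomputable section

namespace BonyAttractor

/-! ### The pointwise ergodic theorem for bounded functions -/

section Birkhoff

variable {X : Type*}

/-- Running maximum of the Birkhoff sums of `f`, truncated below at `0`. -/
def maxSum (T : X → X) (f : X → ℝ) : ℕ → X → ℝ
  | 0 => fun _ => 0
  | n + 1 => fun x => max 0 (f x + maxSum T f n (T x))

theorem maxSum_nonneg (T : X → X) (f : X → ℝ) (n : ℕ) (x : X) : 0 ≤ maxSum T f n x := by
  cases n with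
  | zero => exact le_rfl
  | succ n => exact le_max_left _ _

theorem maxSum_le_succ (T : X → X) (f : X → ℝ) (n : ℕ) (x : X) :
    maxSum T f n x ≤ maxSum T f (n + 1) x := by
  induction n generalizing x with
  | zero => exact le_max_left _ _
  | succ n ih => exact max_le_max le_rfl (add_le_add le_rfl (ih (T x)))

theorem maxSum_mono (T : X → X) (f : X → ℝ) (x : X) : Monotone fun n => maxSum T f n x :=
  monotone_nat_of_le_succ fun n => maxSum_le_succ T f n x

theorem birkhoffSum_le_maxSum (T : X → X) (f : X → ℝ) (n : ℕ) (x : X) :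
    birkhoffSum T f n x ≤ maxSum T f n x := by
  induction n generalizing x with
  | zero => simp [maxSum]
  | succ n ih =>
    rw [birkhoffSum_succ']
    exact (add_le_add le_rfl (ih (T x))).trans (le_max_right _ _)

theorem maxSum_le (T : X → X) (f : X → ℝ) {b : ℝ} (hb : ∀ x, |f x| ≤ b) (n : ℕ) (x : X) :
    maxSum T f n x ≤ n * b := by
  have hb0 : 0 ≤ b := (abs_nonneg _).trans (hb x)
  induction n generalizing x with
  | zero => simp [maxSum]
  | succ n ih =>
    push_cast
    refine max_le (by positivity) ?_
    have := (abs_le.1 (hb x)).2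
    linarith [ih (T x)]

/-- By the recursion, the suprema along `x` and along `T x` control each other. Hence boundedness is
a `T`-invariant event, of measure 0 or 1 when `T` is ergodic. -/
theorem bddAbove_maxSum_iff (T : X → X) (f : X → ℝ) (x : X) :
    BddAbove (range fun n => maxSum T f n (T x)) ↔ BddAbove (range fun n => maxSum T f n x) := by
  constructor
  · rintro ⟨c, hc⟩
    refine ⟨max 0 (f x + c), ?_⟩
    rintro _ ⟨n, rfl⟩
    refine (maxSum_le_succ T f n x).trans ?_
    exact max_le_max le_rfl (add_le_add le_rfl (hc ⟨n, rfl⟩))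
  · rintro ⟨c, hc⟩
    refine ⟨c - f x, ?_⟩
    rintro _ ⟨n, rfl⟩
    have h1 : maxSum T f (n + 1) x ≤ c := hc ⟨n + 1, rfl⟩
    have h2 : f x + maxSum T f n (T x) ≤ maxSum T f (n + 1) x := le_max_right _ _
    simp only
    linarith

theorem birkhoffSum_sub_const (T : X → X) (f : X → ℝ) (c : ℝ) (n : ℕ) (x : X) :
    birkhoffSum T (fun y => f y - c) n x = birkhoffSum T f n x - n * c := by
  simp [birkhoffSum, Finset.sum_sub_distrib]

variable [MeasurableSpace X] {μ : Measure X} {T : X → X}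

theorem measurable_maxSum (hT : Measurable T) {f : X → ℝ} (hf : Measurable f) (n : ℕ) :
    Measurable (maxSum T f n) := by
  induction n with
  | zero => exact measurable_const
  | succ n ih => exact measurable_const.max (hf.add (ih.comp hT))

theorem integrable_of_bound [IsFiniteMeasure μ] {f : X → ℝ} (hf : Measurable f) {b : ℝ}
    (hb : ∀ x, |f x| ≤ b) : Integrable f μ :=
  Integrable.of_bound hf.aestronglyMeasurable b (Eventually.of_forall hb)

/-- If the integral of a bounded function is negative, then its Birkhoff sums over an ergodic
transformation are almost surely bounded above. -/
theorem ae_bddAbove_maxSum [IsProbabilityMeasure μ] (hT : Ergodic T μ) {f : X → ℝ}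
    (hf : Measurable f) {b : ℝ} (hb : ∀ x, |f x| ≤ b) (hneg : ∫ x, f x ∂μ < 0) :
    ∀ᵐ x ∂μ, BddAbove (range fun n => maxSum T f n x) := by
  have hTm := hT.measurable
  set A : Set X := {x | BddAbove (range fun n => maxSum T f n x)} with hA
  have hAm : MeasurableSet A := measurableSet_bddAbove_range fun n => measurable_maxSum hTm hf n
  have hinv : T ⁻¹' A = A := by
    ext x
    exact bddAbove_maxSum_iff T f x
  rcases hT.toPreErgodic.ae_mem_or_ae_notMem hAm hinv with h | h
  · exact h
  -- If the running maxima were unbounded almost everywhere, the truncation at 0 would eventually be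
  -- inactive and M_{n+1} − M_n ∘ T would tend to `f`. These differences are bounded by `b`, and by
  -- invariance and monotonicity their integrals are nonnegative, so ∫ f ≥ 0.
  exfalso
  have hMint : ∀ n, Integrable (maxSum T f n) μ := fun n =>
    integrable_of_bound (measurable_maxSum hTm hf n) (b := n * b) fun x => by
      rw [abs_of_nonneg (maxSum_nonneg T f n x)]
      exact maxSum_le T f hb n x
  have hMT : ∀ n, Integrable (fun x => maxSum T f n (T x)) μ := fun n =>
    hT.toMeasurePreserving.integrable_comp_of_integrable (hMint n)
  have hpos : ∀ n, 0 ≤ ∫ x, (maxSum T f (n + 1) x - maxSum T f n (T x)) ∂μ := by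
    intro n
    rw [integral_sub (hMint _) (hMT n)]
    have h1 : ∫ x, maxSum T f n (T x) ∂μ = ∫ x, maxSum T f n x ∂μ := by
      have := integral_map (μ := μ) hTm.aemeasurable (f := maxSum T f n)
        (measurable_maxSum hTm hf n).aestronglyMeasurable
      rw [hT.toMeasurePreserving.map_eq] at this
      exact this.symm
    rw [h1, sub_nonneg]
    exact integral_mono (hMint n) (hMint (n + 1)) fun x => maxSum_le_succ T f n x
  have hlim : Tendsto (fun n => ∫ x, (maxSum T f (n + 1) x - maxSum T f n (T x)) ∂μ) atTop
      (𝓝 (∫ x, f x ∂μ)) := by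
    refine tendsto_integral_of_dominated_convergence (fun _ => b)
      (fun n => ((hMint _).sub (hMT n)).aestronglyMeasurable) (integrable_const b) ?_ ?_
    · intro n
      refine Eventually.of_forall fun x => ?_
      have h0 := maxSum_nonneg T f n (T x)
      have hfx := abs_le.1 (hb x)
      have hx : maxSum T f (n + 1) x = max 0 (f x + maxSum T f n (T x)) := rfl
      rw [hx, Real.norm_eq_abs, abs_le]
      rcases max_cases 0 (f x + maxSum T f n (T x)) with ⟨h1, h2⟩ | ⟨h1, h2⟩ <;> rw [h1] <;>
        constructor <;> linarith
    · filter_upwards [h] with x hx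
      have hx' : ¬ BddAbove (range fun n => maxSum T f n (T x)) := by
        rw [bddAbove_maxSum_iff]; exact hx
      have hinf : Tendsto (fun n => maxSum T f n (T x)) atTop atTop :=
        tendsto_atTop_atTop_of_monotone (maxSum_mono T f (T x)) fun c => by
          rw [bddAbove_def] at hx'
          push Not at hx'
          obtain ⟨_, ⟨n, rfl⟩, hn⟩ := hx' c
          exact ⟨n, hn.le⟩
      refine tendsto_const_nhds.congr' ?_
      filter_upwards [hinf.eventually_ge_atTop (-f x)] with n hn
      have hx : maxSum T f (n + 1) x = max 0 (f x + maxSum T f n (T x)) := rfl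
      rw [hx, max_eq_right (by linarith)]
      ring
  exact absurd (ge_of_tendsto' hlim hpos) (not_le.2 hneg)

theorem ae_eventually_birkhoffSum_le [IsProbabilityMeasure μ] (hT : Ergodic T μ) {f : X → ℝ}
    (hf : Measurable f) {b : ℝ} (hb : ∀ x, |f x| ≤ b) {ε : ℝ} (hε : 0 < ε) :
    ∀ᵐ x ∂μ, ∀ᶠ n : ℕ in atTop, birkhoffSum T f n x ≤ n * (∫ x, f x ∂μ + ε) := by
  have hint := integrable_of_bound (μ := μ) hf hb
  set c := ∫ x, f x ∂μ + ε / 2 with hc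
  have hneg : ∫ x, (f x - c) ∂μ < 0 := by
    rw [integral_sub hint (integrable_const _)]
    simp [hc]
    linarith
  have hb' : ∀ x, |f x - c| ≤ b + |c| := fun x => (abs_sub _ _).trans (by linarith [hb x])
  filter_upwards [ae_bddAbove_maxSum hT (hf.sub_const c) hb' hneg] with x hx
  obtain ⟨B, hB⟩ := hx
  have hlim : Tendsto (fun n : ℕ => (n : ℝ) * (ε / 2)) atTop atTop :=
    tendsto_natCast_atTop_atTop.atTop_mul_const (by positivity)
  filter_upwards [hlim.eventually_ge_atTop B] with n hn
  have h1 := birkhoffSum_le_maxSum T (fun y => f y - c) n x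
  have h2 : maxSum T (fun y => f y - c) n x ≤ B := hB ⟨n, rfl⟩
  rw [birkhoffSum_sub_const] at h1
  rw [hc] at h1
  nlinarith

/-- The pointwise ergodic theorem for bounded measurable functions. -/
theorem tendsto_birkhoffSum_div [IsProbabilityMeasure μ] (hT : Ergodic T μ) {f : X → ℝ}
    (hf : Measurable f) {b : ℝ} (hb : ∀ x, |f x| ≤ b) :
    ∀ᵐ x ∂μ, Tendsto (fun n : ℕ => birkhoffSum T f n x / n) atTop (𝓝 (∫ x, f x ∂μ)) := by
  have hε : ∀ m : ℕ, (0 : ℝ) < 1 / (m + 1) := fun m => Nat.one_div_pos_of_nat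
  have h1 : ∀ᵐ x ∂μ, ∀ m : ℕ, ∀ᶠ n : ℕ in atTop,
      birkhoffSum T f n x ≤ n * (∫ x, f x ∂μ + 1 / (m + 1)) :=
    ae_all_iff.2 fun m => ae_eventually_birkhoffSum_le hT hf hb (hε m)
  have h2 : ∀ᵐ x ∂μ, ∀ m : ℕ, ∀ᶠ n : ℕ in atTop,
      birkhoffSum T (fun x => -f x) n x ≤ n * (∫ x, -f x ∂μ + 1 / (m + 1)) :=
    ae_all_iff.2 fun m => ae_eventually_birkhoffSum_le (f := fun x => -f x) (b := b) hT hf.neg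
      (fun x => by rw [abs_neg]; exact hb x) (hε m)
  filter_upwards [h1, h2] with x hx1 hx2
  rw [Metric.tendsto_nhds]
  intro ε hε0
  obtain ⟨m, hm⟩ := exists_nat_one_div_lt hε0
  filter_upwards [hx1 m, hx2 m, eventually_gt_atTop 0] with n hn1 hn2 hn0
  have hn : (0 : ℝ) < n := by exact_mod_cast hn0
  have hs : birkhoffSum T (fun x => -f x) n x = -birkhoffSum T f n x := by
    simp [birkhoffSum]
  rw [hs, integral_neg] at hn2
  rw [Real.dist_eq, abs_lt]
  constructor
  · rw [lt_sub_iff_add_lt, lt_div_iff₀ hn]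
    nlinarith
  · rw [sub_lt_iff_lt_add, div_lt_iff₀ hn]
    nlinarith

end Birkhoff

/-! ### The Bernoulli shift -/

section Shift

theorem shift_iterate {S : Type*} (n : ℕ) (ω : ℤ → S) : shift^[n] ω = fun i => ω (i + n) := by
  induction n generalizing ω with
  | zero => simp
  | succ n ih =>
    rw [Function.iterate_succ_apply, ih]
    funext i
    simp only [shift]
    congr 1
    push_cast
    ring

/-- The sequence moved `n` places to the right. -/
def past {S : Type*} (n : ℕ) (ω : ℤ → S) : ℤ → S := fun i => ω (i - n)

theorem shift_iterate_past {S : Type*} (n : ℕ) (ω : ℤ → S) : shift^[n] (past n ω) = ω := by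
  rw [shift_iterate]; funext i; simp [past]

theorem past_shift_iterate {S : Type*} (n : ℕ) (ω : ℤ → S) : past n (shift^[n] ω) = ω := by
  rw [shift_iterate]; funext i; simp [past]

theorem shift_past_succ {S : Type*} (n : ℕ) (ω : ℤ → S) : shift (past (n + 1) ω) = past n ω := by
  funext i
  simp only [shift, past]
  congr 1
  push_cast
  ring

theorem past_zero {S : Type*} (ω : ℤ → S) : past 0 ω = ω := by
  funext i; simp [past]

theorem past_one_iterate {S : Type*} (n : ℕ) (ω : ℤ → S) : (past 1)^[n] ω = past n ω := by
  induction n generalizing ω with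
  | zero => simp [past_zero]
  | succ n ih =>
    rw [Function.iterate_succ_apply, ih]
    funext i
    simp only [past]
    congr 1
    push_cast
    ring

theorem shift_injective {S : Type*} : Function.Injective (shift (S := S)) := by
  intro ω ω' h
  have := past_shift_iterate 1 ω
  rw [← this, Function.iterate_one, h, ← Function.iterate_one (f := shift), past_shift_iterate]

theorem measurable_shift {S : Type*} [MeasurableSpace S] : Measurable (shift (S := S)) :=
  measurable_pi_iff.2 fun n => measurable_pi_apply (n + 1)

theorem measurable_past {S : Type*} [MeasurableSpace S] (n : ℕ) : Measurable (past (S := S) n) :=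
  measurable_pi_iff.2 fun i => measurable_pi_apply (i - n)

theorem continuous_shift {S : Type*} [TopologicalSpace S] : Continuous (shift (S := S)) :=
  continuous_pi fun n => continuous_apply (n + 1)

variable {S : Type*} [MeasurableSpace S] (p : Measure S) [IsProbabilityMeasure p]

theorem measurePreserving_shift :
    MeasurePreserving shift (Measure.infinitePi fun _ : ℤ => p)
      (Measure.infinitePi fun _ : ℤ => p) := by
  refine ⟨measurable_shift, ?_⟩
  have h := Measure.infinitePi_map_piCongrLeft (μ := fun _ : ℤ => p) (Equiv.addRight (-1 : ℤ))
  convert h using 2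
  funext ω i
  obtain ⟨j, rfl⟩ := (Equiv.addRight (-1 : ℤ)).surjective i
  rw [MeasurableEquiv.coe_piCongrLeft, Equiv.piCongrLeft_apply_apply]
  simp [shift]

/-- A uniformly dominated sequence of measures that converges to a multiple of `μ` on a generating
`π`-system converges on all measurable sets. -/
theorem tendsto_measure_of_isPiSystem {X : Type*} {m : MeasurableSpace X} {μ : Measure X}
    [IsProbabilityMeasure μ] (ν : ℕ → Measure X) (hle : ∀ n, ν n ≤ μ) (c : ℝ≥0∞) (hc : c ≠ ⊤)
    {C : Set (Set X)} (hC : IsPiSystem C) (hgen : m = MeasurableSpace.generateFrom C)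
    (huniv : Tendsto (fun n => ν n univ) atTop (𝓝 c))
    (h : ∀ A ∈ C, Tendsto (fun n => ν n A) atTop (𝓝 (c * μ A)))
    {A : Set X} (hA : MeasurableSet A) : Tendsto (fun n => ν n A) atTop (𝓝 (c * μ A)) := by
  have hfin : ∀ n, IsFiniteMeasure (ν n) := fun n => isFiniteMeasure_of_le μ (hle n)
  have key : ∀ A, Tendsto (fun n => ν n A) atTop (𝓝 (c * μ A)) ↔
      Tendsto (fun n => (ν n).real A) atTop (𝓝 (c.toReal * μ.real A)) := by
    intro A
    rw [Measure.real, ← ENNReal.toReal_mul]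
    exact (ENNReal.tendsto_toReal_iff (fun n => measure_ne_top _ _)
      (ENNReal.mul_ne_top hc (measure_ne_top _ _))).symm
  have huniv' : Tendsto (fun n => (ν n).real univ) atTop (𝓝 c.toReal) :=
    (ENNReal.tendsto_toReal_iff (fun n => measure_ne_top _ _) hc).2 huniv
  induction A, hA using MeasurableSpace.induction_on_inter hgen hC with
  | empty => simp
  | basic t ht => exact h t ht
  | compl t htm ih =>
    rw [key] at ih ⊢
    rw [probReal_compl_eq_one_sub htm]
    simp_rw [measureReal_compl htm]
    have := huniv'.sub ih
    convert this using 2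
    ring
  | iUnion f hd hm ih =>
    rw [key]
    have hsum : ∀ ν : Measure X, IsFiniteMeasure ν → HasSum (fun i => ν.real (f i))
        (ν.real (⋃ i, f i)) := fun ν _ => by
      rw [Measure.real, measure_iUnion hd hm, ENNReal.tsum_toReal_eq fun _ => measure_ne_top _ _]
      refine ENNReal.hasSum_toReal ?_
      rw [← measure_iUnion hd hm]
      exact measure_ne_top _ _
    simp_rw [fun n => ((hsum (ν n) (hfin n)).tsum_eq).symm]
    rw [← (hsum μ inferInstance).tsum_eq, ← tsum_mul_left]
    -- The hypothesis that every ν n is at most μ supplies the summable majorant.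
    refine tendsto_tsum_of_dominated_convergence (hsum μ inferInstance).summable
      (fun i => (key _).1 (ih i)) (Eventually.of_forall fun n i => ?_)
    rw [Real.norm_of_nonneg measureReal_nonneg]
    exact ENNReal.toReal_mono (measure_ne_top _ _) (hle n _)

/-- Once `n` is large, the translate of `I₁` by `n` is disjoint from `J`, and disjoint sets of
coordinates are independent. -/
theorem eventually_measure_shift_inter_cylinder (I₁ J : Finset ℤ) {A : Set (∀ _ : I₁, S)}
    {B : Set (∀ _ : J, S)} (hA : MeasurableSet A) (hB : MeasurableSet B) :
    ∀ᶠ n : ℕ in atTop, Measure.infinitePi (fun _ : ℤ => p)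
        (shift^[n] ⁻¹' cylinder I₁ A ∩ cylinder J B) =
      Measure.infinitePi (fun _ : ℤ => p) (cylinder I₁ A) *
        Measure.infinitePi (fun _ : ℤ => p) (cylinder J B) := by
  have hlarge : ∀ᶠ n : ℕ in atTop, ∀ i ∈ I₁, ∀ j ∈ J, j < i + n := by
    refine (Finset.eventually_all I₁).2 fun i _ => (Finset.eventually_all J).2 fun j _ => ?_
    filter_upwards [eventually_gt_atTop (j - i).toNat] with n hn
    have := Int.self_le_toNat (j - i)
    omega
  filter_upwards [hlarge] with n hn
  set μ := Measure.infinitePi fun _ : ℤ => p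
  have hmem : ∀ i : I₁, (i : ℤ) + n ∈ I₁.image (· + (n : ℤ)) := fun i =>
    Finset.mem_image_of_mem _ i.2
  have hdisj : Disjoint (I₁.image (· + (n : ℤ))) J := by
    rw [Finset.disjoint_left]
    intro a ha haJ
    obtain ⟨i, hi, rfl⟩ := Finset.mem_image.1 ha
    exact lt_irrefl _ (hn i hi _ haJ)
  have hind : ProbabilityTheory.iIndepFun (fun (i : ℤ) (ω : ℤ → S) => ω i) μ :=
    ProbabilityTheory.iIndepFun_infinitePi (P := fun _ : ℤ => p) (X := fun _ => id)
      fun _ => measurable_id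
  have h2 := hind.indepFun_finset _ J hdisj fun i => measurable_pi_apply i
  set A' : Set (∀ _ : (I₁.image (· + (n : ℤ)) : Finset ℤ), S) :=
    (fun y (i : I₁) => y ⟨i + n, hmem i⟩) ⁻¹' A with hA'
  have hA'm : MeasurableSet A' :=
    (measurable_pi_iff.2 fun i => measurable_pi_apply _) hA
  have h3 := h2.measure_inter_preimage_eq_mul _ _ hA'm hB
  have e1 : shift^[n] ⁻¹' cylinder I₁ A =
      (fun (ω : ℤ → S) (i : (I₁.image (· + (n : ℤ)) : Finset ℤ)) => ω i) ⁻¹' A' := by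
    ext ω
    simp only [mem_preimage, mem_cylinder, shift_iterate, hA']
    rfl
  have e2 : cylinder J B = (fun (ω : ℤ → S) (i : J) => ω i) ⁻¹' B := rfl
  have e3 : μ (shift^[n] ⁻¹' cylinder I₁ A) = μ (cylinder I₁ A) :=
    ((measurePreserving_shift p).iterate n).measure_preimage
      (MeasurableSet.cylinder I₁ hA).nullMeasurableSet
  rw [← e3, e1, e2, h3]

theorem isMixing_shift : IsMixing (shift (S := S)) (Measure.infinitePi fun _ : ℤ => p) := by
  set μ := Measure.infinitePi fun _ : ℤ => p with hμ
  have hmp : MeasurePreserving shift μ μ := measurePreserving_shift p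
  refine ⟨hmp, fun A B hA hB => ?_⟩
  have hgen := (generateFrom_measurableCylinders (α := fun _ : ℤ => S)).symm
  have hpi := isPiSystem_measurableCylinders (α := fun _ : ℤ => S)
  -- The π-system argument is used twice: first `A` is freed with `B` a cylinder, then `B` is freed
  -- with `A` arbitrary.
  have h1 : ∀ B ∈ measurableCylinders (fun _ : ℤ => S), ∀ A, MeasurableSet A →
      Tendsto (fun n : ℕ => μ (shift^[n] ⁻¹' A ∩ B)) atTop (𝓝 (μ A * μ B)) := by
    intro B hB A hA
    have hBm := MeasurableSet.of_mem_measurableCylinders hB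
    have hap : ∀ (n : ℕ) (A : Set (ℤ → S)), MeasurableSet A →
        ((μ.restrict B).map shift^[n]) A = μ (shift^[n] ⁻¹' A ∩ B) := fun n A hA => by
      rw [Measure.map_apply (hmp.iterate n).measurable hA,
        Measure.restrict_apply ((hmp.iterate n).measurable hA)]
    have := tendsto_measure_of_isPiSystem (μ := μ) (fun n => (μ.restrict B).map shift^[n])
      (fun n => by
        conv_rhs => rw [← (hmp.iterate n).map_eq]
        exact Measure.map_mono Measure.restrict_le_self (hmp.iterate n).measurable) (μ B)
      (measure_ne_top _ _) hpi hgen ?_ ?_ hA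
    · simp_rw [hap _ A hA] at this
      rwa [mul_comm]
    · simp_rw [hap _ univ MeasurableSet.univ]
      simp
    · intro A hA
      simp_rw [hap _ A (MeasurableSet.of_mem_measurableCylinders hA)]
      obtain ⟨I₁, A, hA', rfl⟩ := (mem_measurableCylinders _).1 hA
      obtain ⟨J, B, hB', rfl⟩ := (mem_measurableCylinders _).1 hB
      refine tendsto_const_nhds.congr' ?_
      filter_upwards [eventually_measure_shift_inter_cylinder p I₁ J hA' hB'] with n hn
      rw [hn, mul_comm]
  have hap : ∀ (n : ℕ) (B : Set (ℤ → S)), MeasurableSet B →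
      (μ.restrict (shift^[n] ⁻¹' A)) B = μ (shift^[n] ⁻¹' A ∩ B) := fun n B hB => by
    rw [Measure.restrict_apply hB, inter_comm]
  have := tendsto_measure_of_isPiSystem (μ := μ) (fun n => μ.restrict (shift^[n] ⁻¹' A))
    (fun n => Measure.restrict_le_self) (μ A) (measure_ne_top _ _) hpi hgen ?_ ?_ hB
  · simp_rw [hap _ B hB] at this
    exact this
  · simp_rw [hap _ univ MeasurableSet.univ, inter_univ,
      fun n => (hmp.iterate n).measure_preimage hA.nullMeasurableSet]
    exact tendsto_const_nhds
  · intro B hB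
    simp_rw [hap _ B (MeasurableSet.of_mem_measurableCylinders hB)]
    exact h1 B hB A hA

theorem IsMixing.ergodic {X : Type*} [MeasurableSpace X] {T : X → X} {μ : Measure X}
    [IsProbabilityMeasure μ] (h : IsMixing T μ) : Ergodic T μ where
  toMeasurePreserving := h.1
  aeconst_set s hs hT := by
    have h1 := h.2 s s hs hs
    have h2 : ∀ n : ℕ, T^[n] ⁻¹' s = s := fun n => by
      induction n with
      | zero => simp
      | succ n ih => rw [Function.iterate_succ, preimage_comp, ih, hT]
    simp_rw [h2, inter_self] at h1
    have h3 : μ s = μ s * μ s := tendsto_nhds_unique tendsto_const_nhds h1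
    rw [eventuallyConst_set']
    rcases eq_or_ne (μ s) 0 with h0 | h0
    · left; exact ae_eq_empty.2 h0
    · right
      rw [ae_eq_univ, prob_compl_eq_zero_iff hs]
      exact ((ENNReal.mul_right_inj h0 (measure_ne_top _ _)).1 (by rw [mul_one]; exact h3)).symm

theorem ergodic_shift : Ergodic (shift (S := S)) (Measure.infinitePi fun _ : ℤ => p) :=
  (isMixing_shift p).ergodic

/-- Products along the past are Birkhoff products for the inverse shift, so its ergodicity is needed
as well. -/
theorem ergodic_past_one : Ergodic (past (S := S) 1) (Measure.infinitePi fun _ : ℤ => p) where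
  measurable := measurable_past 1
  map_eq := by
    have h := (measurePreserving_shift p).map_eq
    conv_lhs => rw [← h]
    rw [Measure.map_map (measurable_past 1) measurable_shift]
    have : past (S := S) 1 ∘ shift = id := by
      funext ω; exact past_shift_iterate 1 ω
    rw [this, Measure.map_id]
  aeconst_set s hs hT := by
    refine (ergodic_shift p).aeconst_set hs ?_
    conv_lhs => rw [← hT]
    rw [← preimage_comp]
    have : past (S := S) 1 ∘ shift = id := by
      funext ω; exact past_shift_iterate 1 ω
    rw [this, preimage_id]

end Shift

/-! ### The uniform Bernoulli measure and decay of products of symbol weights -/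

section Uniform

variable {k : ℕ}

theorem uniformOn_real_singleton (a : Fin k) :
    (ProbabilityTheory.uniformOn (univ : Set (Fin k))).real {a} = (k : ℝ)⁻¹ := by
  rw [Measure.real, ProbabilityTheory.uniformOn_univ]
  simp

theorem measurable_symbol {β : Type*} [MeasurableSpace β] (f : Fin k → β) (i : ℤ) :
    Measurable fun ω : Seq k => f (ω i) :=
  (measurable_of_finite f).comp (measurable_pi_apply i)

variable [NeZero k]

instance : IsProbabilityMeasure (bernoulliMeasure k) := by
  unfold bernoulliMeasure; infer_instance

instance : (bernoulliMeasure k).IsOpenPosMeasure where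
  open_pos U hU := by
    rintro ⟨ω, hω⟩
    obtain ⟨s, u, h1, h2⟩ := isOpen_pi_iff.1 hU ω hω
    have h3 : (s : Set ℤ).pi (fun i => {ω i}) ⊆ U := by
      refine fun η hη => h2 fun i hi => ?_
      rw [show η i = ω i from hη i hi]
      exact (h1 i hi).2
    refine (lt_of_lt_of_le ?_ (measure_mono h3)).ne'
    unfold bernoulliMeasure
    rw [Measure.infinitePi_pi _ fun i _ => measurableSet_singleton _]
    refine pos_iff_ne_zero.2 (Finset.prod_ne_zero_iff.2 fun i _ h => ?_)
    have := uniformOn_real_singleton (k := k) (ω i)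
    rw [Measure.real, h] at this
    have hk : (k : ℝ) ≠ 0 := by exact_mod_cast NeZero.ne k
    exact inv_ne_zero hk (by simpa using this.symm)

theorem integral_symbol (f : Fin k → ℝ) (i : ℤ) :
    ∫ ω, f (ω i) ∂bernoulliMeasure k = (∑ a, f a) / k := by
  have h := Measure.infinitePi_map_eval
    (fun _ : ℤ => ProbabilityTheory.uniformOn (univ : Set (Fin k))) i
  have h2 : ∫ ω, f (ω i) ∂bernoulliMeasure k
      = ∫ a, f a ∂ProbabilityTheory.uniformOn (univ : Set (Fin k)) := by
    rw [← h, integral_map (measurable_pi_apply i).aemeasurable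
      (measurable_of_finite f).aestronglyMeasurable]
    rfl
  rw [h2, integral_fintype Integrable.of_finite]
  simp_rw [uniformOn_real_singleton, smul_eq_mul]
  rw [← Finset.mul_sum, div_eq_inv_mul]

/-- Products of positive numbers with geometric mean less than `1`, read along almost every orbit,
decay exponentially. -/
theorem ae_prod_decay {T : Seq k → Seq k} (hT : Ergodic T (bernoulliMeasure k)) (i : ℤ)
    {Λ : Fin k → ℝ} (hΛ : ∀ a, 0 < Λ a) (hneg : ∑ a, Real.log (Λ a) < 0) :
    ∀ᵐ ω ∂bernoulliMeasure k, ∃ c > 0, ∀ᶠ n : ℕ in atTop,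
      ∏ j ∈ Finset.range n, Λ (T^[j] ω i) ≤ Real.exp (-c * n) := by
  have hk : (0 : ℝ) < k := by exact_mod_cast Nat.pos_of_ne_zero (NeZero.ne k)
  have hm := measurable_symbol (fun a => Real.log (Λ a)) i
  have hb : ∀ ω : Seq k, |Real.log (Λ (ω i))| ≤ ∑ a, |Real.log (Λ a)| := fun ω =>
    Finset.single_le_sum (f := fun a => |Real.log (Λ a)|) (fun a _ => abs_nonneg _)
      (Finset.mem_univ _)
  -- The tolerance is half the absolute value of the negative mean, so half of the decay rate
  -- survives.
  have h := ae_eventually_birkhoffSum_le hT hm hb (ε := -(∑ a, Real.log (Λ a)) / k / 2)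
    (by have := div_pos (neg_pos.2 hneg) hk; positivity)
  filter_upwards [h] with ω hω
  refine ⟨-(∑ a, Real.log (Λ a)) / k / 2, by have := div_pos (neg_pos.2 hneg) hk; positivity, ?_⟩
  filter_upwards [hω] with n hn
  rw [integral_symbol (fun a => Real.log (Λ a))] at hn
  rw [← Real.log_le_iff_le_exp (Finset.prod_pos fun j _ => hΛ _),
    Real.log_prod fun j _ => (hΛ _).ne']
  refine hn.trans (le_of_eq ?_)
  ring

theorem ae_prod_decay_forward {Λ : Fin k → ℝ} (hΛ : ∀ a, 0 < Λ a)
    (hneg : ∑ a, Real.log (Λ a) < 0) :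
    ∀ᵐ ω ∂bernoulliMeasure k, ∃ c > 0, ∀ᶠ n : ℕ in atTop,
      ∏ j ∈ Finset.range n, Λ (ω j) ≤ Real.exp (-c * n) := by
  filter_upwards [ae_prod_decay (ergodic_shift _) 0 hΛ hneg] with ω h
  simpa [shift_iterate] using h

theorem ae_prod_decay_backward {Λ : Fin k → ℝ} (hΛ : ∀ a, 0 < Λ a)
    (hneg : ∑ a, Real.log (Λ a) < 0) :
    ∀ᵐ ω ∂bernoulliMeasure k, ∃ c > 0, ∀ᶠ n : ℕ in atTop,
      ∏ j ∈ Finset.range n, Λ (ω (-1 - j)) ≤ Real.exp (-c * n) := by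
  filter_upwards [ae_prod_decay (ergodic_past_one _) (-1) hΛ hneg] with ω h
  simpa [past_one_iterate, past] using h

end Uniform

/-! ### Fibers of the maximal attractor -/

namespace RandomMap

variable {k : ℕ} (G : RandomMap k)

theorem toMap_iterate (n : ℕ) (ω : Seq k) (x : I) :
    G.toMap^[n] (ω, x) = (shift^[n] ω, G.fibIter n ω x) := by
  refine Prod.ext ?_ rfl
  induction n generalizing ω x with
  | zero => rfl
  | succ n ih =>
    rw [Function.iterate_succ_apply, Function.iterate_succ_apply]
    exact ih _ _

theorem fibIter_zero (ω : Seq k) (x : I) : G.fibIter 0 ω x = x := rfl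

theorem fibIter_succ (n : ℕ) (ω : Seq k) (x : I) :
    G.fibIter (n + 1) ω x = G.fibIter n (shift ω) (G.fib ω x) := rfl

theorem fibIter_succ' (n : ℕ) (ω : Seq k) (x : I) :
    G.fibIter (n + 1) ω x = G.fib (shift^[n] ω) (G.fibIter n ω x) := by
  have : G.toMap^[n + 1] (ω, x) = G.toMap (G.toMap^[n] (ω, x)) :=
    Function.iterate_succ_apply' _ _ _
  rw [toMap_iterate G n] at this
  exact congrArg Prod.snd this

theorem continuous_toMap : Continuous G.toMap :=
  (continuous_shift.comp continuous_fst).prodMk G.continuous_fib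

theorem toMap_injective : Function.Injective G.toMap := by
  rintro ⟨ω, x⟩ ⟨ω', x'⟩ h
  have h1 : ω = ω' := shift_injective (congrArg Prod.fst h)
  subst h1
  have h2 : G.fib ω x = G.fib ω x' := congrArg Prod.snd h
  rw [(G.diffeo ω).injective h2]

theorem continuous_fibIter_uncurry (n : ℕ) :
    Continuous fun z : Seq k × I => G.fibIter n z.1 z.2 :=
  continuous_snd.comp (G.continuous_toMap.iterate n)

theorem continuous_fibIter (n : ℕ) (ω : Seq k) : Continuous (G.fibIter n ω) :=
  (G.continuous_fibIter_uncurry n).comp (Continuous.prodMk_right ω)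

theorem continuous_fib_apply (ω : Seq k) : Continuous (G.fib ω) :=
  G.continuous_fib.comp (Continuous.prodMk_right ω)

theorem fibIter_injective (n : ℕ) (ω : Seq k) : Function.Injective (G.fibIter n ω) := by
  intro x y h
  have h1 : G.toMap^[n] (ω, x) = G.toMap^[n] (ω, y) := by rw [toMap_iterate, toMap_iterate, h]
  exact congrArg Prod.snd (G.toMap_injective.iterate n h1)

theorem maxAttractor_nested (n : ℕ) : range G.toMap^[n + 1] ⊆ range G.toMap^[n] := by
  rintro _ ⟨z, rfl⟩
  exact ⟨G.toMap z, rfl⟩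

theorem isClosed_maxAttractor : IsClosed G.maxAttractor :=
  isClosed_iInter fun n => (isCompact_range (G.continuous_toMap.iterate n)).isClosed

theorem image_maxAttractor : G.toMap '' G.maxAttractor = G.maxAttractor := by
  unfold maxAttractor
  rw [(G.toMap_injective.injOn).image_iInter_eq]
  apply Subset.antisymm
  · refine subset_iInter fun n => (iInter_subset _ n).trans ?_
    rintro _ ⟨_, ⟨z, rfl⟩, rfl⟩
    exact ⟨G.toMap z, by rw [← Function.iterate_succ_apply, Function.iterate_succ_apply']⟩
  · refine subset_iInter fun n => (iInter_subset _ (n + 1)).trans ?_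
    rintro _ ⟨z, rfl⟩
    exact ⟨_, ⟨z, rfl⟩, (Function.iterate_succ_apply' _ _ _).symm⟩

/-- The fiber of the maximal attractor over `ω`. -/
def sec (ω : Seq k) : Set I := {x | (ω, x) ∈ G.maxAttractor}

theorem mem_range_iterate_iff (n : ℕ) (ω : Seq k) (x : I) :
    (ω, x) ∈ range G.toMap^[n] ↔ x ∈ range (G.fibIter n (past n ω)) := by
  constructor
  · rintro ⟨⟨η, y⟩, h⟩
    rw [toMap_iterate] at h
    obtain ⟨h1, h2⟩ := Prod.mk.inj h
    rw [← h1, past_shift_iterate]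
    exact ⟨y, h2⟩
  · rintro ⟨y, rfl⟩
    exact ⟨(past n ω, y), by rw [toMap_iterate, shift_iterate_past]⟩

theorem mem_sec_iff {ω : Seq k} {x : I} :
    x ∈ G.sec ω ↔ ∀ n, x ∈ range (G.fibIter n (past n ω)) := by
  simp only [sec, maxAttractor, mem_ofPred_eq, mem_iInter, mem_range_iterate_iff]

theorem sec_eq_iInter (ω : Seq k) : G.sec ω = ⋂ n, range (G.fibIter n (past n ω)) := by
  ext x; simp [mem_sec_iff]

theorem isCompact_sec (ω : Seq k) : IsCompact (G.sec ω) :=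
  (G.isClosed_maxAttractor.preimage (Continuous.prodMk_right ω)).isCompact

theorem nonempty_sec (ω : Seq k) : (G.sec ω).Nonempty := by
  rw [sec_eq_iInter]
  refine IsCompact.nonempty_iInter_of_sequence_nonempty_isCompact_isClosed _ (fun n => ?_)
    (fun n => range_nonempty _) (isCompact_range (G.continuous_fibIter 0 _))
    fun n => (isCompact_range (G.continuous_fibIter n _)).isClosed
  intro x hx
  rw [← mem_range_iterate_iff] at hx ⊢
  exact G.maxAttractor_nested n hx

/-- Each fiber is an intersection of continuous images of `I`, that is, of intervals; this is why
bones are intervals. -/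
theorem ordConnected_sec (ω : Seq k) : (G.sec ω).OrdConnected := by
  rw [sec_eq_iInter]
  exact ordConnected_iInter fun n =>
    (isPreconnected_range (G.continuous_fibIter n _)).ordConnected

theorem sec_shift (ω : Seq k) : G.sec (shift ω) = G.fib ω '' G.sec ω := by
  ext x
  constructor
  · intro h
    have h' : (shift ω, x) ∈ G.toMap '' G.maxAttractor := by
      rw [image_maxAttractor]; exact h
    obtain ⟨⟨η, y⟩, hy, he⟩ := h'
    obtain ⟨h1, h2⟩ := Prod.mk.inj he
    obtain rfl : η = ω := shift_injective h1
    exact ⟨y, hy, h2⟩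
  · rintro ⟨y, hy, rfl⟩
    have : (shift ω, G.fib ω y) ∈ G.toMap '' G.maxAttractor := ⟨(ω, y), hy, rfl⟩
    rwa [image_maxAttractor] at this

/-- The base points over which the maximal attractor is a single point. -/
def pointSet : Set (Seq k) := {ω | (G.sec ω).Subsingleton}

/-- The least point of the maximal attractor in a fiber. -/
def lowerPoint (ω : Seq k) : I := ((G.isCompact_sec ω).exists_isLeast (G.nonempty_sec ω)).choose

theorem isLeast_lowerPoint (ω : Seq k) : IsLeast (G.sec ω) (G.lowerPoint ω) :=
  ((G.isCompact_sec ω).exists_isLeast (G.nonempty_sec ω)).choose_spec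

theorem lowerPoint_mem (ω : Seq k) : G.lowerPoint ω ∈ G.sec ω := (G.isLeast_lowerPoint ω).1

theorem exists_sec_eq_Icc (ω : Seq k) : ∃ b, G.sec ω = Icc (G.lowerPoint ω) b := by
  obtain ⟨b, hb⟩ := (G.isCompact_sec ω).exists_isGreatest (G.nonempty_sec ω)
  exact ⟨b, Subset.antisymm (fun x hx => ⟨(G.isLeast_lowerPoint ω).2 hx, hb.2 hx⟩)
    ((G.ordConnected_sec ω).out (G.lowerPoint_mem ω) hb.1)⟩

theorem shift_mem_pointSet_iff {ω : Seq k} : shift ω ∈ G.pointSet ↔ ω ∈ G.pointSet := by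
  simp only [pointSet, mem_ofPred_eq, sec_shift]
  exact ⟨fun h => subsingleton_of_image (G.diffeo ω).injective _ h, fun h => h.image _⟩

theorem fib_lowerPoint {ω : Seq k} (h : ω ∈ G.pointSet) :
    G.fib ω (G.lowerPoint ω) = G.lowerPoint (shift ω) := by
  have h1 : G.fib ω (G.lowerPoint ω) ∈ G.sec (shift ω) := by
    rw [sec_shift]; exact mem_image_of_mem _ (G.lowerPoint_mem ω)
  exact G.shift_mem_pointSet_iff.2 h h1 (G.lowerPoint_mem _)

theorem image_graph : G.toMap '' graphOver G.pointSet G.lowerPoint =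
    graphOver G.pointSet G.lowerPoint := by
  ext ⟨ω, x⟩
  constructor
  · rintro ⟨⟨η, y⟩, ⟨h1, h2⟩, h3⟩
    obtain ⟨rfl, rfl⟩ := Prod.mk.inj h3
    exact ⟨G.shift_mem_pointSet_iff.2 h1, by simp only at h2; rw [h2, G.fib_lowerPoint h1]⟩
  · rintro ⟨h1, h2⟩
    have hs : shift (past 1 ω) = ω := shift_iterate_past 1 ω
    simp only at h1 h2
    have h4 : past 1 ω ∈ G.pointSet := by rw [← shift_mem_pointSet_iff, hs]; exact h1
    refine ⟨(past 1 ω, G.lowerPoint (past 1 ω)), ⟨h4, rfl⟩, ?_⟩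
    simp only [toMap, G.fib_lowerPoint h4, hs, h2]

/-- The attractor is closed in a compact space, so its fibers are upper semicontinuous; a selection
is continuous wherever the fiber is a single point. -/
theorem continuousOn_lowerPoint : ContinuousOn G.lowerPoint G.pointSet := by
  intro ω hω
  refine ContinuousAt.continuousWithinAt ?_
  rw [ContinuousAt, (nhds_basis_opens _).tendsto_right_iff]
  rintro V ⟨hV, hVo⟩
  have h1 : IsClosed (Prod.fst '' (G.maxAttractor ∩ (univ ×ˢ Vᶜ))) :=
    isClosedMap_fst_of_compactSpace _
      (G.isClosed_maxAttractor.inter (isClosed_univ.prod hVo.isClosed_compl))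
  have h2 : ω ∈ (Prod.fst '' (G.maxAttractor ∩ (univ ×ˢ Vᶜ)))ᶜ := by
    rintro ⟨⟨η, y⟩, ⟨hy, -, hyV⟩, rfl⟩
    have : y = G.lowerPoint η := hω hy (G.lowerPoint_mem η)
    exact hyV (this ▸ hV)
  filter_upwards [h1.isOpen_compl.mem_nhds h2] with η hη
  by_contra hc
  exact hη ⟨(η, G.lowerPoint η), ⟨G.lowerPoint_mem η, trivial, hc⟩, rfl⟩

/-- The least point is lower semicontinuous: its sublevel sets are projections of compact sets. -/
theorem measurable_lowerPoint : Measurable G.lowerPoint := by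
  refine measurable_of_Iic fun c => ?_
  have : G.lowerPoint ⁻¹' Iic c = Prod.fst '' (G.maxAttractor ∩ (univ ×ˢ Iic c)) := by
    ext ω
    constructor
    · exact fun h => ⟨(ω, G.lowerPoint ω), ⟨G.lowerPoint_mem ω, trivial, h⟩, rfl⟩
    · rintro ⟨⟨η, y⟩, ⟨hy, -, hyc⟩, rfl⟩
      exact ((G.isLeast_lowerPoint η).2 hy).trans hyc
  rw [this]
  exact (isClosedMap_fst_of_compactSpace _ (G.isClosed_maxAttractor.inter
    (isClosed_univ.prod isClosed_Iic))).measurableSet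

/-- The complement is a countable union of projections of compact sets, those of pairs in a common
fiber at distance at least 1/(n+1). -/
theorem measurableSet_pointSet : MeasurableSet G.pointSet := by
  have : G.pointSetᶜ = ⋃ n : ℕ, Prod.fst '' {z : Seq k × (I × I) | (z.1, z.2.1) ∈ G.maxAttractor ∧
      (z.1, z.2.2) ∈ G.maxAttractor ∧ 1 / ((n : ℝ) + 1) ≤ Dist.dist z.2.1 z.2.2} := by
    ext ω
    simp only [mem_compl_iff, pointSet, mem_ofPred_eq, Set.not_subsingleton_iff, mem_iUnion]
    constructor
    · rintro ⟨x, hx, y, hy, hxy⟩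
      obtain ⟨n, hn⟩ := exists_nat_one_div_lt (dist_pos.2 hxy)
      exact ⟨n, (ω, x, y), ⟨hx, hy, hn.le⟩, rfl⟩
    · rintro ⟨n, ⟨η, x, y⟩, ⟨hx, hy, h⟩, rfl⟩
      refine ⟨x, hx, y, hy, dist_pos.1 (lt_of_lt_of_le Nat.one_div_pos_of_nat h)⟩
  rw [← MeasurableSet.compl_iff, this]
  refine MeasurableSet.iUnion fun n => (isClosedMap_fst_of_compactSpace _ ?_).measurableSet
  refine (G.isClosed_maxAttractor.preimage (by fun_prop)).inter
    ((G.isClosed_maxAttractor.preimage (by fun_prop)).inter ?_)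
  exact isClosed_le continuous_const (continuous_snd.fst.dist continuous_snd.snd)

theorem graph_subset_maxAttractor : graphOver G.pointSet G.lowerPoint ⊆ G.maxAttractor := by
  rintro ⟨ω, x⟩ ⟨-, h⟩
  simp only at h
  rw [h]
  exact G.lowerPoint_mem ω

/-- If the fibers of the maximal attractor are contained in the closure of the graph, then the
maximal attractor is a continuous or a bony graph. -/
theorem continuousGraph_or_bonyGraph [NeZero k]
    (hae : ∀ᵐ ω ∂bernoulliMeasure k, ω ∈ G.pointSet)
    (hcl : ∀ ω ∉ G.pointSet, ∀ x ∈ G.sec ω, (ω, x) ∈ closure (graphOver G.pointSet G.lowerPoint)) :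
    IsContinuousGraph G.pointSet G.lowerPoint G.maxAttractor ∨
      IsBonyGraph G.pointSet G.lowerPoint G.maxAttractor := by
  by_cases h : G.pointSet = univ
  · refine Or.inl ⟨h, ?_, ?_⟩
    · have := G.continuousOn_lowerPoint
      rwa [h, continuousOn_univ] at this
    · refine Subset.antisymm ?_ G.graph_subset_maxAttractor
      rintro ⟨ω, x⟩ hx
      have hω : ω ∈ G.pointSet := h ▸ mem_univ ω
      exact ⟨hω, hω hx (G.lowerPoint_mem ω)⟩
  · refine Or.inr ⟨hae, G.continuousOn_lowerPoint,
      {B | ∃ ω ∉ G.pointSet, B = {ω} ×ˢ G.sec ω}, ?_, ?_, ?_⟩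
    · obtain ⟨ω, hω⟩ := (ne_univ_iff_exists_notMem _).1 h
      exact ⟨_, ω, hω, rfl⟩
    · rintro _ ⟨ω, hω, rfl⟩
      constructor
      · obtain ⟨b, hb⟩ := G.exists_sec_eq_Icc ω
        refine ⟨ω, hω, G.lowerPoint ω, b, ?_, by rw [hb]⟩
        by_contra hlt
        refine hω ?_
        simp only [pointSet, mem_ofPred_eq, hb]
        exact subsingleton_Icc_of_ge (not_lt.1 hlt)
      · rintro ⟨η, x⟩ ⟨rfl, hx⟩
        exact hcl _ hω x hx
    · apply Subset.antisymm
      · rintro ⟨ω, x⟩ hx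
        by_cases hω : ω ∈ G.pointSet
        · exact Or.inl ⟨hω, hω hx (G.lowerPoint_mem ω)⟩
        · exact Or.inr ⟨_, ⟨ω, hω, rfl⟩, rfl, hx⟩
      · refine union_subset G.graph_subset_maxAttractor ?_
        rintro ⟨η, x⟩ ⟨_, ⟨ω, hω, rfl⟩, rfl, hx⟩
        exact hx

/-- The fiber maps are Lipschitz, with constants that only depend on the symbol at index `0`. -/
def LipBound (Λ : Fin k → ℝ) : Prop :=
  ∀ (ω : Seq k) (x y : I), |(G.fib ω x : ℝ) - G.fib ω y| ≤ Λ (ω 0) * |(x : ℝ) - y|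

variable {G} {Λ : Fin k → ℝ}

theorem LipBound.fibIter (h : G.LipBound Λ) (hΛ : ∀ a, 0 < Λ a) (n : ℕ) (ω : Seq k) (x y : I) :
    |(G.fibIter n ω x : ℝ) - G.fibIter n ω y| ≤
      (∏ j ∈ Finset.range n, Λ (ω j)) * |(x : ℝ) - y| := by
  induction n with
  | zero => simp [fibIter_zero]
  | succ n ih =>
    rw [fibIter_succ', fibIter_succ', Finset.prod_range_succ]
    refine (h _ _ _).trans ?_
    have : shift^[n] ω 0 = ω n := by simp [shift_iterate]
    rw [this, mul_comm (∏ j ∈ Finset.range n, Λ (ω j)), mul_assoc]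
    exact mul_le_mul_of_nonneg_left ih (hΛ _).le

theorem abs_sub_le_one (x y : I) : |(x : ℝ) - y| ≤ 1 := by
  have hx := x.2
  have hy := y.2
  rw [abs_le]
  constructor <;> linarith [hx.1, hx.2, hy.1, hy.2]

/-- Bounds the diameter of the n-th image of the full fiber that lands over `ω`; the factors are
read backwards from index −1. -/
theorem LipBound.fibIter_past (h : G.LipBound Λ) (hΛ : ∀ a, 0 < Λ a) (n : ℕ) (ω : Seq k)
    (x y : I) : |(G.fibIter n (past n ω) x : ℝ) - G.fibIter n (past n ω) y| ≤
      ∏ j ∈ Finset.range n, Λ (ω (-1 - j)) := by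
  refine (h.fibIter hΛ n _ x y).trans ?_
  have : ∏ j ∈ Finset.range n, Λ (past n ω j) = ∏ j ∈ Finset.range n, Λ (ω (-1 - j)) := by
    rw [← Finset.prod_range_reflect]
    refine Finset.prod_congr rfl fun j hj => ?_
    rw [Finset.mem_range] at hj
    simp only [past]
    congr 2
    omega
  rw [this]
  exact mul_le_of_le_one_right (Finset.prod_nonneg fun j _ => (hΛ _).le) (abs_sub_le_one x y)

theorem LipBound.mem_pointSet (h : G.LipBound Λ) (hΛ : ∀ a, 0 < Λ a) {ω : Seq k} {c : ℝ}
    (hc : 0 < c) (hω : ∀ᶠ n : ℕ in atTop,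
      ∏ j ∈ Finset.range n, Λ (ω (-1 - j)) ≤ Real.exp (-c * n)) : ω ∈ G.pointSet := by
  intro x hx y hy
  have hlim : Tendsto (fun n : ℕ => Real.exp (-c * n)) atTop (𝓝 0) :=
    Real.tendsto_exp_atBot.comp
      (tendsto_natCast_atTop_atTop.const_mul_atTop_of_neg (neg_lt_zero.2 hc))
  have h0 : |(x : ℝ) - y| ≤ 0 := by
    refine ge_of_tendsto hlim ?_
    filter_upwards [hω] with n hn
    obtain ⟨x', rfl⟩ := G.mem_sec_iff.1 hx n
    obtain ⟨y', rfl⟩ := G.mem_sec_iff.1 hy n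
    exact (h.fibIter_past hΛ n ω x' y').trans hn
  exact Subtype.ext (sub_eq_zero.1 (abs_nonpos_iff.1 h0))

theorem LipBound.ae_mem_pointSet [NeZero k] (h : G.LipBound Λ) (hΛ : ∀ a, 0 < Λ a)
    (hneg : ∑ a, Real.log (Λ a) < 0) : ∀ᵐ ω ∂bernoulliMeasure k, ω ∈ G.pointSet := by
  filter_upwards [ae_prod_decay_backward hΛ hneg] with ω ⟨c, hc, hω⟩
  exact h.mem_pointSet hΛ hc hω

end RandomMap

/-! ### The invariant measure on the graph -/

namespace RandomMap

variable {k : ℕ} (G : RandomMap k)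

theorem measurable_graphMap : Measurable fun ω : Seq k => (ω, G.lowerPoint ω) :=
  measurable_id.prodMk G.measurable_lowerPoint

theorem toMap_iterate_graph {G : RandomMap k} {ω : Seq k} (h : ω ∈ G.pointSet) (n : ℕ) :
    G.toMap^[n] (ω, G.lowerPoint ω) = (shift^[n] ω, G.lowerPoint (shift^[n] ω)) := by
  induction n generalizing ω with
  | zero => rfl
  | succ n ih =>
    rw [Function.iterate_succ_apply, Function.iterate_succ_apply,
      ← ih (G.shift_mem_pointSet_iff.2 h), ← G.fib_lowerPoint h]
    rfl

theorem measurableSet_graph : MeasurableSet (graphOver G.pointSet G.lowerPoint) :=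
  (measurable_fst G.measurableSet_pointSet).inter
    (measurableSet_eq_fun measurable_snd (G.measurable_lowerPoint.comp measurable_fst))

variable [NeZero k]

/-- The lift of the Bernoulli measure to the graph of `lowerPoint`. -/
def graphMeasure : Measure (Seq k × I) :=
  (bernoulliMeasure k).map fun ω => (ω, G.lowerPoint ω)

instance : IsProbabilityMeasure G.graphMeasure :=
  Measure.isProbabilityMeasure_map G.measurable_graphMap.aemeasurable

theorem measurePreserving_graphMap :
    MeasurePreserving (fun ω => (ω, G.lowerPoint ω)) (bernoulliMeasure k) G.graphMeasure :=
  ⟨G.measurable_graphMap, rfl⟩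

theorem measurePreserving_fst_graphMeasure :
    MeasurePreserving Prod.fst G.graphMeasure (bernoulliMeasure k) := by
  refine ⟨measurable_fst, ?_⟩
  rw [graphMeasure, Measure.map_map measurable_fst G.measurable_graphMap]
  exact Measure.map_id

variable {G}

/-- Almost everywhere the graph map `ω ↦ (ω, G.lowerPoint ω)` intertwines the shift with `G.toMap`,
so invariance and correlations are those of the shift. -/
theorem isMixing_graphMeasure (hae : ∀ᵐ ω ∂bernoulliMeasure k, ω ∈ G.pointSet) :
    IsMixing G.toMap G.graphMeasure := by
  have hmix : IsMixing shift (bernoulliMeasure k) := isMixing_shift _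
  have hψ := G.measurePreserving_graphMap
  have hTm : Measurable G.toMap := G.continuous_toMap.measurable
  refine ⟨⟨hTm, ?_⟩, fun A B hA hB => ?_⟩
  · have h1 : (G.toMap ∘ fun ω => (ω, G.lowerPoint ω)) =ᵐ[bernoulliMeasure k]
        ((fun ω => (ω, G.lowerPoint ω)) ∘ shift) := by
      filter_upwards [hae] with ω hω
      exact toMap_iterate_graph hω 1
    conv_lhs => rw [graphMeasure]
    rw [Measure.map_map hTm hψ.measurable, Measure.map_congr h1,
      ← Measure.map_map hψ.measurable measurable_shift, hmix.1.map_eq]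
    rfl
  · have h1 := hmix.2 _ _ (hψ.measurable hA) (hψ.measurable hB)
    rw [hψ.measure_preimage hA.nullMeasurableSet, hψ.measure_preimage hB.nullMeasurableSet] at h1
    refine h1.congr fun n => ?_
    rw [← hψ.measure_preimage (((hTm.iterate n) hA).inter hB).nullMeasurableSet]
    refine measure_congr ?_
    filter_upwards [hae] with ω hω
    refine propext (and_congr ?_ Iff.rfl)
    change (shift^[n] ω, G.lowerPoint (shift^[n] ω)) ∈ A ↔
      G.toMap^[n] (ω, G.lowerPoint ω) ∈ A
    rw [toMap_iterate_graph hω n]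

theorem ae_graphMeasure_iff {P : Seq k × I → Prop} (hP : MeasurableSet {z | P z}) :
    (∀ᵐ z ∂G.graphMeasure, P z) ↔ ∀ᵐ ω ∂bernoulliMeasure k, P (ω, G.lowerPoint ω) :=
  ae_map_iff G.measurable_graphMap.aemeasurable hP

theorem ae_mem_graph (hae : ∀ᵐ ω ∂bernoulliMeasure k, ω ∈ G.pointSet) :
    ∀ᵐ z ∂G.graphMeasure, z ∈ graphOver G.pointSet G.lowerPoint := by
  refine (ae_graphMeasure_iff (P := (· ∈ graphOver G.pointSet G.lowerPoint))
    G.measurableSet_graph).2 ?_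
  filter_upwards [hae] with ω hω
  exact ⟨hω, rfl⟩

theorem isBernoulli_graphMeasure (hae : ∀ᵐ ω ∂bernoulliMeasure k, ω ∈ G.pointSet) :
    IsBernoulli G.toMap G.graphMeasure := by
  refine ⟨(isMixing_graphMeasure hae).1, Fin k, inferInstance, inferInstance,
    ProbabilityTheory.uniformOn univ, inferInstance, Prod.fst, fun ω => (ω, G.lowerPoint ω),
    G.measurePreserving_fst_graphMeasure, G.measurePreserving_graphMap, ?_,
    Eventually.of_forall fun _ => rfl, Eventually.of_forall fun _ => rfl⟩
  filter_upwards [ae_mem_graph hae] with z hz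
  exact Prod.ext rfl hz.2.symm

/-- Nonempty open subsets of the base have positive measure, and by continuity on `pointSet` the
graph over a small one stays in a given neighbourhood of a graph point. -/
theorem support_graphMeasure (hae : ∀ᵐ ω ∂bernoulliMeasure k, ω ∈ G.pointSet) :
    G.graphMeasure.support = closure (graphOver G.pointSet G.lowerPoint) := by
  apply Subset.antisymm
  · exact Measure.support_subset_of_isClosed isClosed_closure
      ((ae_mem_graph hae).mono fun z hz => subset_closure hz)
  · refine closure_minimal ?_ Measure.isClosed_support
    rintro ⟨ω, x⟩ ⟨hω, hx⟩
    simp only at hω hx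
    subst hx
    rw [Measure.mem_support_iff_forall]
    intro V hV
    have h1 : ContinuousWithinAt (fun ω => (ω, G.lowerPoint ω)) G.pointSet ω :=
      continuousWithinAt_id.prodMk (G.continuousOn_lowerPoint ω hω)
    obtain ⟨W, hWo, hωW, hW⟩ := mem_nhdsWithin.1 (h1 hV)
    have h2 : 0 < bernoulliMeasure k W := hWo.measure_pos _ ⟨ω, hωW⟩
    have h3 : bernoulliMeasure k W ≤ bernoulliMeasure k
        ((fun ω => (ω, G.lowerPoint ω)) ⁻¹' V) := by
      refine measure_mono_ae ?_
      filter_upwards [hae] with η hη hηW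
      exact hW ⟨hηW, hη⟩
    exact h2.trans_le (h3.trans (Measure.le_map_apply G.measurable_graphMap.aemeasurable V))

end RandomMap

/-! ### Continuity of the invariant measure -/

section SeqDist

variable {k : ℕ}

theorem seqDist_le {ω ω' : Seq k} {n : ℕ} (h : ∀ i : ℤ, i.natAbs < n → ω i = ω' i) :
    seqDist ω ω' ≤ (1 / 2) ^ n := by
  unfold seqDist
  split_ifs with he
  · positivity
  · refine pow_le_pow_of_le_one (by norm_num) (by norm_num) ?_
    obtain ⟨i, hi⟩ := Function.ne_iff.1 he
    refine le_csInf ⟨_, i, rfl, hi⟩ ?_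
    rintro m ⟨j, rfl, hj⟩
    by_contra hlt
    exact hj (h j (not_le.1 hlt))

theorem eventually_seqDist_lt (ω : Seq k) {ε : ℝ} (hε : 0 < ε) :
    ∀ᶠ ω' in 𝓝 ω, seqDist ω' ω < ε := by
  obtain ⟨n, hn⟩ := exists_pow_lt_of_lt_one hε (by norm_num : (1 / 2 : ℝ) < 1)
  have h : ∀ᶠ ω' in 𝓝 ω, ∀ i ∈ Finset.Ioo (-(n : ℤ)) n, ω' i = ω i :=
    (Finset.eventually_all _).2 fun i _ =>
      (continuous_apply i).continuousAt.eventually_mem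
        ((isOpen_discrete ({ω i} : Set (Fin k))).mem_nhds rfl)
  filter_upwards [h] with ω' hω'
  refine (seqDist_le fun i hi => hω' i ?_).trans_lt hn
  rw [Finset.mem_Ioo]
  omega

theorem continuous_of_hutchinson {f : Seq k × I → ℝ}
    (hf : ∀ y z, |f y - f z| ≤ seqDist y.1 z.1 + |(y.2 : ℝ) - z.2|) : Continuous f := by
  rw [continuous_iff_continuousAt]
  intro z
  rw [Metric.continuousAt_iff']
  intro ε hε
  have h1 : ∀ᶠ y : Seq k × I in 𝓝 z, seqDist y.1 z.1 < ε / 2 :=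
    continuous_fst.continuousAt.eventually (eventually_seqDist_lt z.1 (half_pos hε))
  have h2 : ∀ᶠ y : Seq k × I in 𝓝 z, dist y.2 z.2 < ε / 2 :=
    continuous_snd.continuousAt.eventually (Metric.ball_mem_nhds z.2 (half_pos hε))
  filter_upwards [h1, h2] with y hy1 hy2
  have h3 : dist y.2 z.2 = |(y.2 : ℝ) - z.2| := rfl
  rw [Real.dist_eq]
  rw [h3] at hy2
  linarith [hf y z]

theorem ofReal_iteratedDerivWithin_sub_le (f g : I → I) {j : ℕ} (hj : j ≤ 2) {x : ℝ}
    (hx : x ∈ Icc (0 : ℝ) 1) : ENNReal.ofReal |iteratedDerivWithin j (lift f) (Icc 0 1) x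
      - iteratedDerivWithin j (lift g) (Icc 0 1) x| ≤ c2Dist f g :=
  le_iSup₂_of_le x hx (le_iSup₂_of_le (f := fun j (_ : j ∈ Iic (2 : ℕ)) => ENNReal.ofReal
    |iteratedDerivWithin j (lift f) (Icc 0 1) x - iteratedDerivWithin j (lift g) (Icc 0 1) x|)
    j hj le_rfl)

theorem lift_coe (f : I → I) (x : I) : lift f x = f x := by
  simp [lift]

theorem ofReal_abs_sub_le_c2Dist (f g : I → I) (x : I) :
    ENNReal.ofReal |(f x : ℝ) - g x| ≤ c2Dist f g := by
  have := ofReal_iteratedDerivWithin_sub_le f g (j := 0) (by norm_num) x.2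
  simpa [lift_coe] using this

theorem c2Dist_le_dist (G H : RandomMap k) (ω : Seq k) :
    c2Dist (G.fib ω) (H.fib ω) ≤ G.dist H :=
  (le_max_left _ _).trans (le_iSup (fun ω => max (c2Dist (G.fib ω) (H.fib ω))
    (c2DistInv (G.fib ω) (H.fib ω))) ω)

end SeqDist

namespace RandomMap

variable {k : ℕ} {G H : RandomMap k} {Λ : Fin k → ℝ}

/-- Telescoping over the steps at which the two maps are exchanged. The exponential factor is
harmless because `n` is fixed before `d`. -/
theorem LipBound.abs_fibIter_sub_le (hG : G.LipBound Λ) {L d : ℝ}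
    (hL : 1 ≤ L) (hΛL : ∀ a, Λ a ≤ L) (hd : 0 ≤ d)
    (hGH : ∀ ω x, |(G.fib ω x : ℝ) - H.fib ω x| ≤ d) (n : ℕ) (ω : Seq k) (x : I) :
    |(G.fibIter n ω x : ℝ) - H.fibIter n ω x| ≤ n * L ^ n * d := by
  induction n with
  | zero => simp [fibIter_zero]
  | succ n ih =>
    rw [fibIter_succ', fibIter_succ']
    have h1 := hG (shift^[n] ω) (G.fibIter n ω x) (H.fibIter n ω x)
    have h2 := hGH (shift^[n] ω) (H.fibIter n ω x)
    have h3 : Λ (shift^[n] ω 0) * |(G.fibIter n ω x : ℝ) - H.fibIter n ω x| ≤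
        L * (n * L ^ n * d) :=
      mul_le_mul (hΛL _) ih (abs_nonneg _) (by linarith)
    have h4 : 1 * d ≤ L ^ (n + 1) * d := mul_le_mul_of_nonneg_right (one_le_pow₀ hL) hd
    refine (abs_sub_le _ (G.fib (shift^[n] ω) (H.fibIter n ω x) : ℝ) _).trans ?_
    refine (add_le_add (h1.trans h3) h2).trans ?_
    push_cast
    rw [pow_succ] at h4 ⊢
    nlinarith

/-- Both points are n-th images over the same past. The minimum with 1 keeps the first term
dominated, since the products themselves may be large on a small set of pasts. -/
theorem LipBound.abs_lowerPoint_sub_le (hG : G.LipBound Λ) (hΛ : ∀ a, 0 < Λ a) {L d : ℝ}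
    (hL : 1 ≤ L) (hΛL : ∀ a, Λ a ≤ L) (hd : 0 ≤ d)
    (hGH : ∀ ω x, |(G.fib ω x : ℝ) - H.fib ω x| ≤ d) (n : ℕ) (ω : Seq k) :
    |(H.lowerPoint ω : ℝ) - G.lowerPoint ω| ≤
      min 1 (∏ j ∈ Finset.range n, Λ (ω (-1 - j))) + n * L ^ n * d := by
  have hnn : 0 ≤ n * L ^ n * d := by positivity
  obtain ⟨p, hp⟩ := G.mem_sec_iff.1 (G.lowerPoint_mem ω) n
  obtain ⟨q, hq⟩ := H.mem_sec_iff.1 (H.lowerPoint_mem ω) n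
  rw [min_add, le_min_iff]
  constructor
  · linarith [abs_sub_le_one (H.lowerPoint ω) (G.lowerPoint ω)]
  · rw [← hp, ← hq, abs_sub_comm]
    have h1 := hG.fibIter_past hΛ n ω p q
    have h2 := hG.abs_fibIter_sub_le hL hΛL hd hGH n (past n ω) q
    exact (abs_sub_le _ (G.fibIter n (past n ω) q : ℝ) _).trans (add_le_add h1 h2)

variable [NeZero k]

/-- Both measures are images of the same Bernoulli measure, so matching the points over each `ω` is
a coupling whose cost involves the fiber distance only. -/
theorem hutchinsonDist_graphMeasure_le (G H : RandomMap k) :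
    hutchinsonDist H.graphMeasure G.graphMeasure ≤
      ENNReal.ofReal (∫ ω, |(H.lowerPoint ω : ℝ) - G.lowerPoint ω| ∂bernoulliMeasure k) := by
  refine iSup₂_le fun f hf => ENNReal.ofReal_le_ofReal ?_
  have hc : Continuous f := continuous_of_hutchinson hf
  obtain ⟨b, hb⟩ := (isCompact_range hc).isBounded.exists_norm_le
  have hint : ∀ F : RandomMap k, Integrable (fun ω => f (ω, F.lowerPoint ω))
      (bernoulliMeasure k) := fun F =>
    integrable_of_bound (hc.measurable.comp F.measurable_graphMap) (b := b)
      fun ω => hb _ (mem_range_self _)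
  have hmap : ∀ F : RandomMap k, ∫ z, f z ∂F.graphMeasure =
      ∫ ω, f (ω, F.lowerPoint ω) ∂bernoulliMeasure k := fun F =>
    integral_map F.measurable_graphMap.aemeasurable hc.aestronglyMeasurable
  rw [hmap, hmap, ← integral_sub (hint H) (hint G)]
  refine (abs_integral_le_integral_abs).trans ?_
  refine integral_mono ((hint H).sub (hint G)).abs ?_ fun ω => ?_
  · refine integrable_of_bound (b := 1) ?_ fun ω => ?_
    · exact ((measurable_subtype_coe.comp H.measurable_lowerPoint).sub
        (measurable_subtype_coe.comp G.measurable_lowerPoint)).abs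
    · rw [abs_abs]; exact abs_sub_le_one _ _
  · refine (hf _ _).trans (le_of_eq ?_)
    simp [seqDist]

theorem tendsto_integral_min_prod (hΛ : ∀ a, 0 < Λ a) (hneg : ∑ a, Real.log (Λ a) < 0) :
    Tendsto (fun n : ℕ => ∫ ω : Seq k, min 1 (∏ j ∈ Finset.range n, Λ (ω (-1 - j)))
      ∂bernoulliMeasure k) atTop (𝓝 0) := by
  have hpos : ∀ (n : ℕ) (ω : Seq k), 0 ≤ min 1 (∏ j ∈ Finset.range n, Λ (ω (-1 - j))) :=
    fun n ω => le_min zero_le_one (Finset.prod_nonneg fun j _ => (hΛ _).le)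
  have h := tendsto_integral_of_dominated_convergence (μ := bernoulliMeasure k)
    (F := fun (n : ℕ) ω => min 1 (∏ j ∈ Finset.range n, Λ (ω (-1 - j)))) (f := fun _ => 0)
    (fun _ => 1) (fun n => ?_) (integrable_const _) (fun n => ?_) ?_
  · simpa using h
  · exact (measurable_const.min (Finset.measurable_prod _ fun j _ =>
      measurable_symbol Λ _)).aestronglyMeasurable
  · refine Eventually.of_forall fun ω => ?_
    rw [Real.norm_of_nonneg (hpos n ω)]
    exact min_le_left _ _
  · filter_upwards [ae_prod_decay_backward hΛ hneg] with ω ⟨c, hc, hω⟩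
    have hlim : Tendsto (fun n : ℕ => Real.exp (-c * n)) atTop (𝓝 0) :=
      Real.tendsto_exp_atBot.comp
        (tendsto_natCast_atTop_atTop.const_mul_atTop_of_neg (neg_lt_zero.2 hc))
    refine tendsto_of_tendsto_of_tendsto_of_le_of_le' tendsto_const_nhds hlim
      (Eventually.of_forall fun n => hpos n ω) ?_
    filter_upwards [hω] with n hn
    exact (min_le_right _ _).trans hn

theorem LipBound.hutchinson_continuity (hG : G.LipBound Λ) (hΛ : ∀ a, 0 < Λ a)
    (hneg : ∑ a, Real.log (Λ a) < 0) {ε : ℝ≥0∞} (hε : 0 < ε) :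
    ∃ δ : ℝ≥0∞, 0 < δ ∧ ∀ H : RandomMap k, G.dist H < δ →
      hutchinsonDist H.graphMeasure G.graphMeasure < ε := by
  obtain ⟨e, he0, heε⟩ : ∃ e : ℝ, 0 < e ∧ ENNReal.ofReal e ≤ ε := by
    rcases eq_or_ne ε ⊤ with rfl | h
    · exact ⟨1, one_pos, le_top⟩
    · exact ⟨ε.toReal, ENNReal.toReal_pos hε.ne' h, (ENNReal.ofReal_toReal h).le⟩
  set L : ℝ := 1 + ∑ a, Λ a with hLdef
  have hL : 1 ≤ L := le_add_of_nonneg_right (Finset.sum_nonneg fun a _ => (hΛ a).le)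
  have hΛL : ∀ a, Λ a ≤ L := fun a =>
    (Finset.single_le_sum (f := Λ) (fun a _ => (hΛ a).le) (Finset.mem_univ a)).trans
      (le_add_of_nonneg_left zero_le_one)
  -- First `n` makes the mean contraction term smaller than e/2; only then is δ chosen, to make the
  -- perturbation of `n` steps smaller than e/2.
  obtain ⟨n, hn⟩ := ((tendsto_integral_min_prod hΛ hneg).eventually_lt_const
    (half_pos he0)).exists
  have hLn : 0 < n * L ^ n + 1 := by positivity
  refine ⟨ENNReal.ofReal (e / 2 / (n * L ^ n + 1)), ENNReal.ofReal_pos.2 (by positivity),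
    fun H hH => ?_⟩
  set d := e / 2 / (n * L ^ n + 1) with hd
  have hd0 : 0 < d := by positivity
  have hGH : ∀ ω x, |(G.fib ω x : ℝ) - H.fib ω x| ≤ d := fun ω x =>
    (ENNReal.ofReal_le_ofReal_iff hd0.le).1
      ((ofReal_abs_sub_le_c2Dist _ _ x).trans ((c2Dist_le_dist G H ω).trans hH.le))
  refine lt_of_lt_of_le ((hutchinsonDist_graphMeasure_le G H).trans_lt ?_) heε
  refine (ENNReal.ofReal_lt_ofReal_iff he0).2 ?_
  have hm : Integrable (fun ω : Seq k => min 1 (∏ j ∈ Finset.range n, Λ (ω (-1 - j))))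
      (bernoulliMeasure k) := by
    refine integrable_of_bound (measurable_const.min (Finset.measurable_prod _ fun j _ =>
      measurable_symbol Λ _)) (b := 1) fun ω => ?_
    rw [abs_of_nonneg (le_min zero_le_one (Finset.prod_nonneg fun j _ => (hΛ _).le))]
    exact min_le_left _ _
  have h1 : ∫ ω, |(H.lowerPoint ω : ℝ) - G.lowerPoint ω| ∂bernoulliMeasure k ≤
      ∫ ω : Seq k, (min 1 (∏ j ∈ Finset.range n, Λ (ω (-1 - j))) + n * L ^ n * d)
        ∂bernoulliMeasure k := by
    refine integral_mono ?_ (hm.add (integrable_const _))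
      fun ω => hG.abs_lowerPoint_sub_le hΛ hL hΛL hd0.le hGH n ω
    refine integrable_of_bound (b := 1) ?_ fun ω => ?_
    · exact ((measurable_subtype_coe.comp H.measurable_lowerPoint).sub
        (measurable_subtype_coe.comp G.measurable_lowerPoint)).abs
    · rw [abs_abs]; exact abs_sub_le_one _ _
  rw [integral_add hm (integrable_const _)] at h1
  have h2 : n * L ^ n * d < e / 2 := by
    rw [hd, mul_div_assoc', div_lt_iff₀ hLn]
    nlinarith
  simp only [integral_const, probReal_univ, one_smul] at h1
  linarith

end RandomMap

/-! ### The fiber Lyapunov exponent -/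

namespace RandomMap

variable {k : ℕ}

/-- `ψ ω z` is the logarithm of the absolute value of the derivative of `G.fib ω` at `z`, as a
limit of difference quotients, uniformly with rate `K`. -/
def HasLogDeriv (G : RandomMap k) (ψ : Seq k → I → ℝ) (K : ℝ) : Prop :=
  ∀ (ω : Seq k) (x y z : I) (r : ℝ), x ≠ y → |(x : ℝ) - z| ≤ r → |(y : ℝ) - z| ≤ r →
    |Real.log (|(G.fib ω x : ℝ) - G.fib ω y| / |(x : ℝ) - y|) - ψ ω z| ≤ K * r

variable {G : RandomMap k} {Λ : Fin k → ℝ} {ψ : Seq k → I → ℝ} {K : ℝ}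

theorem fibIter_lowerPoint {ω : Seq k} (h : ω ∈ G.pointSet) (n : ℕ) :
    G.fibIter n ω (G.lowerPoint ω) = G.lowerPoint (shift^[n] ω) := by
  have := toMap_iterate_graph h n
  rw [toMap_iterate] at this
  exact congrArg Prod.snd this

theorem abs_pos_of_ne {x y : I} (h : x ≠ y) : 0 < |(x : ℝ) - y| :=
  abs_pos.2 (sub_ne_zero.2 fun h' => h (Subtype.ext h'))

/-- The difference quotient of an iterate telescopes into one-step quotients. At time i the images
of `x` and `y` lie within the i-th product of the graph point, so each one-step quotient is read off
there with error at most `K` times that product. -/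
theorem HasLogDeriv.abs_log_fibIter_sub_le (h : G.HasLogDeriv ψ K)
    (hL : G.LipBound Λ) (hΛ : ∀ a, 0 < Λ a) {ω : Seq k} (hω : ω ∈ G.pointSet) {x y : I}
    (hxy : x ≠ y) (n : ℕ) :
    |Real.log (|(G.fibIter n ω x : ℝ) - G.fibIter n ω y| / |(x : ℝ) - y|) -
      birkhoffSum shift (fun η => ψ η (G.lowerPoint η)) n ω| ≤
      K * ∑ i ∈ Finset.range n, ∏ j ∈ Finset.range i, Λ (ω j) := by
  have h0 := abs_pos_of_ne hxy
  induction n with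
  | zero => simp [fibIter_zero, div_self h0.ne']
  | succ n ih =>
    have hne : G.fibIter n ω x ≠ G.fibIter n ω y := (G.fibIter_injective n ω).ne hxy
    have hne' : G.fibIter (n + 1) ω x ≠ G.fibIter (n + 1) ω y :=
      (G.fibIter_injective (n + 1) ω).ne hxy
    have h1 := abs_pos_of_ne hne
    have h2 := abs_pos_of_ne hne'
    have hclose : ∀ w : I, |(G.fibIter n ω w : ℝ) - G.lowerPoint (shift^[n] ω)| ≤
        ∏ j ∈ Finset.range n, Λ (ω j) := fun w => by
      rw [← fibIter_lowerPoint hω]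
      refine (hL.fibIter hΛ n ω w _).trans ?_
      exact mul_le_of_le_one_right (Finset.prod_nonneg fun j _ => (hΛ _).le) (abs_sub_le_one _ _)
    have h3 := h (shift^[n] ω) _ _ _ _ hne (hclose x) (hclose y)
    rw [← fibIter_succ', ← fibIter_succ'] at h3
    rw [birkhoffSum_succ, Finset.sum_range_succ, mul_add]
    have h4 : Real.log (|(G.fibIter (n + 1) ω x : ℝ) - G.fibIter (n + 1) ω y| / |(x : ℝ) - y|) =
        Real.log (|(G.fibIter n ω x : ℝ) - G.fibIter n ω y| / |(x : ℝ) - y|) +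
        Real.log (|(G.fibIter (n + 1) ω x : ℝ) - G.fibIter (n + 1) ω y| /
          |(G.fibIter n ω x : ℝ) - G.fibIter n ω y|) := by
      rw [← Real.log_mul (by positivity) (by positivity)]
      congr 1
      field_simp
    rw [h4, add_sub_add_comm]
    exact (abs_add_le _ _).trans (add_le_add ih h3)

/-- A point of the interval at distance `r` from `z`. -/
def nearPoint (r : ℝ) (z : I) : I :=
  if (z : ℝ) ≤ 1 / 2 then projIcc 0 1 zero_le_one (z + r) else projIcc 0 1 zero_le_one (z - r)

theorem measurable_nearPoint (r : ℝ) : Measurable (nearPoint r) :=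
  Measurable.ite (measurableSet_le measurable_subtype_coe measurable_const)
    (continuous_projIcc.measurable.comp (measurable_subtype_coe.add_const r))
    (continuous_projIcc.measurable.comp (measurable_subtype_coe.sub_const r))

theorem abs_nearPoint_sub {r : ℝ} (hr : 0 < r) (hr2 : r ≤ 1 / 2) (z : I) :
    |(nearPoint r z : ℝ) - z| = r := by
  have h0 := z.2.1
  have h1 := z.2.2
  unfold nearPoint
  split_ifs with h
  · rw [projIcc_of_mem zero_le_one (⟨by linarith, by linarith⟩ : (z : ℝ) + r ∈ Icc (0 : ℝ) 1)]
    simp [abs_of_pos hr]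
  · rw [projIcc_of_mem zero_le_one (⟨by linarith, by linarith⟩ : (z : ℝ) - r ∈ Icc (0 : ℝ) 1)]
    simp [abs_of_pos hr]

theorem nearPoint_ne {r : ℝ} (hr : 0 < r) (hr2 : r ≤ 1 / 2) (z : I) : nearPoint r z ≠ z := by
  intro h
  have := abs_nearPoint_sub hr hr2 z
  rw [h] at this
  simp at this
  linarith

theorem HasLogDeriv.abs_log_nearPoint_sub_le (h : G.HasLogDeriv ψ K) (ω : Seq k) (z : I) {r : ℝ}
    (hr : 0 < r) (hr2 : r ≤ 1 / 2) :
    |Real.log (|(G.fib ω (nearPoint r z) : ℝ) - G.fib ω z| / r) - ψ ω z| ≤ K * r := by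
  have := h ω (nearPoint r z) z z r (nearPoint_ne hr hr2 z) (abs_nearPoint_sub hr hr2 z).le
    (by simpa using hr.le)
  rwa [abs_nearPoint_sub hr hr2] at this

/-- `ψ` is an arbitrary function, so measurability comes from its being a pointwise limit of
logarithms of difference quotients. -/
theorem HasLogDeriv.measurable (h : G.HasLogDeriv ψ K) :
    Measurable fun ω => ψ ω (G.lowerPoint ω) := by
  refine measurable_of_tendsto_metrizable (f := fun (n : ℕ) ω => Real.log
    (|(G.fib ω (nearPoint (1 / (n + 2)) (G.lowerPoint ω)) : ℝ) - G.fib ω (G.lowerPoint ω)| /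
      (1 / ((n : ℝ) + 2)))) (fun n => ?_) (tendsto_pi_nhds.2 fun ω => ?_)
  · have hm := G.continuous_fib.measurable
    have h1 : Measurable fun ω => G.fib ω (nearPoint (1 / ((n : ℝ) + 2)) (G.lowerPoint ω)) :=
      hm.comp (measurable_id.prodMk ((measurable_nearPoint _).comp G.measurable_lowerPoint))
    have h2 : Measurable fun ω => G.fib ω (G.lowerPoint ω) :=
      hm.comp (measurable_id.prodMk G.measurable_lowerPoint)
    exact Real.measurable_log.comp (((measurable_subtype_coe.comp h1).sub
      (measurable_subtype_coe.comp h2)).abs.div_const _)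
  · rw [tendsto_iff_dist_tendsto_zero]
    have hlim : Tendsto (fun n : ℕ => K * (1 / ((n : ℝ) + 2))) atTop (𝓝 0) := by
      have := ((tendsto_one_div_add_atTop_nhds_zero_nat (𝕜 := ℝ)).comp
        (tendsto_add_atTop_nat 1)).const_mul K
      rw [mul_zero] at this
      refine this.congr fun n => ?_
      simp only [Function.comp]
      push_cast
      ring
    refine squeeze_zero (fun _ => dist_nonneg) (fun n => ?_) hlim
    have hn : (0 : ℝ) < (n : ℝ) + 2 := by positivity
    refine h.abs_log_nearPoint_sub_le ω (G.lowerPoint ω) (by positivity) ?_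
    exact one_div_le_one_div_of_le two_pos (by linarith [(Nat.cast_nonneg n : (0 : ℝ) ≤ n)])

theorem HasLogDeriv.le_log (h : G.HasLogDeriv ψ K) (hL : G.LipBound Λ) (ω : Seq k) (z : I) :
    ψ ω z ≤ Real.log (Λ (ω 0)) := by
  have hlim : Tendsto (fun r : ℝ => Real.log (Λ (ω 0)) + K * r) (𝓝[>] 0)
      (𝓝 (Real.log (Λ (ω 0)))) := by
    have : Continuous fun r : ℝ => Real.log (Λ (ω 0)) + K * r := by fun_prop
    have h2 := this.tendsto 0
    simp only [mul_zero, add_zero] at h2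
    exact h2.mono_left nhdsWithin_le_nhds
  refine ge_of_tendsto hlim ?_
  filter_upwards [Ioo_mem_nhdsGT (by norm_num : (0 : ℝ) < 1 / 2)] with r hr
  have h1 := (abs_le.1 (h.abs_log_nearPoint_sub_le ω z hr.1 hr.2.le)).1
  have h2 : Real.log (|(G.fib ω (nearPoint r z) : ℝ) - G.fib ω z| / r) ≤
      Real.log (Λ (ω 0)) := by
    refine Real.log_le_log (div_pos (abs_pos_of_ne
      ((G.diffeo ω).injective.ne (nearPoint_ne hr.1 hr.2.le z))) hr.1) ?_
    rw [div_le_iff₀ hr.1]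
    have := hL ω (nearPoint r z) z
    rwa [abs_nearPoint_sub hr.1 hr.2.le] at this
  linarith

theorem log_lipNorm_mem {f : I → I} {a b : ℝ}
    (h : ∀ x y : I, x ≠ y → 0 < |(f x : ℝ) - f y| / |(x : ℝ) - y| ∧
      Real.log (|(f x : ℝ) - f y| / |(x : ℝ) - y|) ∈ Icc a b) :
    Real.log (lipNorm f) ∈ Icc a b := by
  have hne : (0 : I) ≠ 1 := zero_ne_one
  have hbdd : ∀ r ∈ {r : ℝ | ∃ x y : I, x ≠ y ∧ r = |(f x : ℝ) - f y| / |(x : ℝ) - y|},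
      r ≤ Real.exp b := by
    rintro _ ⟨x, y, hxy, rfl⟩
    exact (Real.log_le_iff_le_exp (h x y hxy).1).1 (h x y hxy).2.2
  have h1 : lipNorm f ≤ Real.exp b := csSup_le ⟨_, 0, 1, hne, rfl⟩ hbdd
  have h2 : Real.exp a ≤ lipNorm f := by
    refine le_trans ?_ (le_csSup ⟨_, hbdd⟩ ⟨0, 1, hne, rfl⟩)
    exact (Real.le_log_iff_exp_le (h 0 1 hne).1).1 (h 0 1 hne).2.1
  have h3 : 0 < lipNorm f := (Real.exp_pos a).trans_le h2
  exact ⟨(Real.le_log_iff_exp_le h3).2 h2, (Real.log_le_iff_le_exp h3).2 h1⟩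

/-- Products along almost every future are summable, so the distortion is bounded uniformly in `n`
and in the pair of points. The exponent is therefore the space average of `ψ` along the graph, which
is at most the mean of log Λ. -/
theorem HasLogDeriv.exists_exponent [NeZero k] (h : G.HasLogDeriv ψ K) (hK : 0 ≤ K)
    (hL : G.LipBound Λ) (hΛ : ∀ a, 0 < Λ a) (hneg : ∑ a, Real.log (Λ a) < 0) {b : ℝ}
    (hψ : ∀ ω z, |ψ ω z| ≤ b) : ∃ lam < 0, G.HasFiberExponent lam := by
  set φ : Seq k → ℝ := fun ω => ψ ω (G.lowerPoint ω) with hφ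
  have hφm : Measurable φ := h.measurable
  have hφb : ∀ ω, |φ ω| ≤ b := fun ω => hψ _ _
  have hk : (0 : ℝ) < k := by exact_mod_cast Nat.pos_of_ne_zero (NeZero.ne k)
  refine ⟨∫ ω, φ ω ∂bernoulliMeasure k, ?_, ?_⟩
  · refine lt_of_le_of_lt ?_ (div_neg_of_neg_of_pos hneg hk)
    rw [← integral_symbol (fun a => Real.log (Λ a)) 0]
    refine integral_mono (integrable_of_bound hφm hφb) ?_ fun ω => h.le_log hL ω _
    exact integrable_of_bound (measurable_symbol (fun a => Real.log (Λ a)) 0)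
      (b := ∑ a, |Real.log (Λ a)|) fun ω =>
        Finset.single_le_sum (f := fun a => |Real.log (Λ a)|) (fun a _ => abs_nonneg _)
          (Finset.mem_univ _)
  · filter_upwards [hL.ae_mem_pointSet hΛ hneg, ae_prod_decay_forward hΛ hneg,
      tendsto_birkhoffSum_div (ergodic_shift _) hφm hφb] with ω hω ⟨c, hc, hdecay⟩ hlim
    have hsum : Summable fun i : ℕ => ∏ j ∈ Finset.range i, Λ (ω j) := by
      have hgeo : Summable fun i : ℕ => Real.exp (-c * i) := by
        have := Real.summable_exp_nat_mul_iff.2 (neg_lt_zero.2 hc)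
        refine this.congr fun i => ?_
        rw [mul_comm]
      refine hgeo.of_norm_bounded_eventually_nat ?_
      filter_upwards [hdecay] with n hn
      rwa [Real.norm_of_nonneg (Finset.prod_nonneg fun j _ => (hΛ _).le)]
    set B := K * ∑' i : ℕ, ∏ j ∈ Finset.range i, Λ (ω j) with hB
    have hmem : ∀ n : ℕ, |Real.log (lipNorm (G.fibIter n ω)) - birkhoffSum shift φ n ω| ≤ B := by
      intro n
      have : Real.log (lipNorm (G.fibIter n ω)) ∈
          Icc (birkhoffSum shift φ n ω - B) (birkhoffSum shift φ n ω + B) := by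
        refine log_lipNorm_mem fun x y hxy => ⟨div_pos (abs_pos_of_ne
          ((G.fibIter_injective n ω).ne hxy)) (abs_pos_of_ne hxy), ?_⟩
        have h1 := h.abs_log_fibIter_sub_le hL hΛ hω hxy n
        have h2 : K * ∑ i ∈ Finset.range n, ∏ j ∈ Finset.range i, Λ (ω j) ≤ B :=
          mul_le_mul_of_nonneg_left (hsum.sum_le_tsum _ fun i _ =>
            Finset.prod_nonneg fun j _ => (hΛ _).le) hK
        have h3 := abs_le.1 (h1.trans h2)
        exact ⟨by linarith [h3.1], by linarith [h3.2]⟩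
      rw [abs_le]
      exact ⟨by linarith [this.1], by linarith [this.2]⟩
    have hdiff : Tendsto (fun n : ℕ => (Real.log (lipNorm (G.fibIter n ω)) -
        birkhoffSum shift φ n ω) / n) atTop (𝓝 0) := by
      refine squeeze_zero_norm (fun n => ?_) (tendsto_const_div_atTop_nhds_zero_nat B)
      rw [norm_div, Real.norm_eq_abs, Real.norm_natCast]
      exact div_le_div_of_nonneg_right (hmem n) (Nat.cast_nonneg n)
    have := hdiff.add hlim
    rw [zero_add] at this
    refine this.congr fun n => ?_
    rw [← add_div, sub_add_cancel]

end RandomMap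

/-! ### Bones lie in the closure of the graph -/

/-- The two sequences have the same symbols at all indices `≥ -s`. -/
def AgreeFrom {k : ℕ} (s : ℕ) (ω ω' : Seq k) : Prop := ∀ i : ℤ, -(s : ℤ) ≤ i → ω i = ω' i

theorem AgreeFrom.shift {k : ℕ} {s : ℕ} {ω ω' : Seq k} (h : AgreeFrom s ω ω') :
    AgreeFrom (s + 1) (shift ω) (shift ω') := fun i hi => h (i + 1) (by push_cast at hi; omega)

/-- The decreasing cubic model map, with an attracting cycle of period two and a repelling fixed
point. -/
def cubicMap (x : ℝ) : ℝ := 1 / 2 - (1.081 * (x - 1 / 2) - 0.4 * (x - 1 / 2) ^ 3)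

/-- The affine contracting model map. -/
def affineMap (x : ℝ) : ℝ := 0.02 + 0.9 * x

/-- Quantitative closeness of a random map to the step skew product that applies `cubicMap` for
the symbol `0` and `affineMap` for the other symbols, with fiber maps that depend little on
the remote past. -/
structure IsBlender {k : ℕ} [NeZero k] (G : RandomMap k) : Prop where
  expand : ∀ ω (x y : I), 0.75 * |(x : ℝ) - y| ≤ |(G.fib ω x : ℝ) - G.fib ω y|
  range : ∀ ω (x : I), (G.fib ω x : ℝ) ∈ Icc (0.009 : ℝ) 0.991
  memory : ∀ (s : ℕ) (ω ω' : Seq k), AgreeFrom s ω ω' → ∀ x : I,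
    |(G.fib ω x : ℝ) - G.fib ω' x| ≤ 0.0004 * 0.6 ^ s
  contract_of_ne : ∀ ω : Seq k, ω 0 ≠ 0 → ∀ x y : I,
    |(G.fib ω x : ℝ) - G.fib ω y| ≤ 0.998 * |(x : ℝ) - y|
  contract_low : ∀ ω : Seq k, ω 0 = 0 → ∀ x y : I, (G.fib ω x : ℝ) ≤ 0.215 →
    (G.fib ω y : ℝ) ≤ 0.215 → |(G.fib ω x : ℝ) - G.fib ω y| ≤ 0.998 * |(x : ℝ) - y|
  contract_high : ∀ ω : Seq k, ω 0 = 0 → ∀ x y : I, 0.785 ≤ (G.fib ω x : ℝ) →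
    0.785 ≤ (G.fib ω y : ℝ) → |(G.fib ω x : ℝ) - G.fib ω y| ≤ 0.998 * |(x : ℝ) - y|
  near_cubic : ∀ ω : Seq k, ω 0 = 0 → ∀ x : I, |(G.fib ω x : ℝ) - cubicMap x| ≤ 0.0001
  near_affine : ∀ ω : Seq k, ω 0 ≠ 0 → ∀ x : I, |(G.fib ω x : ℝ) - affineMap x| ≤ 0.0001

theorem mem_uIcc_of_injective {f : I → I} (hf : Continuous f) (hi : Function.Injective f)
    {p q x : I} (h : x ∈ uIcc p q) : f x ∈ uIcc (f p) (f q) := by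
  rcases hf.strictMono_of_inj hi with hm | hm
  · exact hm.monotone.image_uIcc_subset (mem_image_of_mem f h)
  · exact hm.antitone.image_uIcc_subset (mem_image_of_mem f h)

theorem exists_fib_eq {f : I → I} (hf : Continuous f) {a b : I} {y : I}
    (h : y ∈ uIcc (f a) (f b)) : ∃ x ∈ uIcc a b, f x = y :=
  intermediate_value_uIcc hf.continuousOn h

namespace IsBlender

variable {k : ℕ} [NeZero k] {G : RandomMap k}

/-- By the lower bound on expansion and the intermediate value theorem, the image of the interval of
radius ρ about `p` contains the interval of radius 0.75 ρ about the image of `p`. -/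
theorem exists_fib_eq_near (h : IsBlender G) (ω : Seq k) {p y : I} {ρ : ℝ}
    (h0 : 0 ≤ (p : ℝ) - ρ) (h1 : (p : ℝ) + ρ ≤ 1) (hρ : 0 ≤ ρ)
    (hy : |(y : ℝ) - G.fib ω p| ≤ 0.75 * ρ) : ∃ x : I, G.fib ω x = y ∧ |(x : ℝ) - p| ≤ ρ := by
  set a : I := ⟨p - ρ, h0, by linarith⟩ with ha
  set b : I := ⟨p + ρ, by linarith, h1⟩ with hb
  have hpa : |(p : ℝ) - a| = ρ := by simp [ha, abs_of_nonneg hρ]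
  have hpb : |(p : ℝ) - b| = ρ := by simp [hb, abs_of_nonneg hρ]
  have ea := h.expand ω p a
  have eb := h.expand ω p b
  rw [hpa] at ea
  rw [hpb] at eb
  have hap : a ≤ p := Subtype.coe_le_coe.1 (by simp [ha, hρ])
  have hpb' : p ≤ b := Subtype.coe_le_coe.1 (by simp [hb, hρ])
  rw [abs_le] at hy
  have hmem : y ∈ uIcc (G.fib ω a) (G.fib ω b) := by
    rcases (G.continuous_fib_apply ω).strictMono_of_inj (G.diffeo ω).injective with hm | hm
    · have h2 : (G.fib ω a : ℝ) ≤ G.fib ω p := hm.monotone hap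
      have h3 : (G.fib ω p : ℝ) ≤ G.fib ω b := hm.monotone hpb'
      rw [abs_of_nonneg (by linarith)] at ea
      rw [abs_of_nonpos (by linarith)] at eb
      refine mem_uIcc.2 (Or.inl ⟨Subtype.coe_le_coe.1 ?_, Subtype.coe_le_coe.1 ?_⟩) <;>
        linarith
    · have h2 : (G.fib ω p : ℝ) ≤ G.fib ω a := hm.antitone hap
      have h3 : (G.fib ω b : ℝ) ≤ G.fib ω p := hm.antitone hpb'
      rw [abs_of_nonpos (by linarith)] at ea
      rw [abs_of_nonneg (by linarith)] at eb
      refine mem_uIcc.2 (Or.inr ⟨Subtype.coe_le_coe.1 ?_, Subtype.coe_le_coe.1 ?_⟩) <;>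
        linarith
  obtain ⟨x, hx, hxy⟩ := exists_fib_eq (G.continuous_fib_apply ω) hmem
  refine ⟨x, hxy, ?_⟩
  rw [uIcc_of_le (hap.trans hpb')] at hx
  have hx1 : (p : ℝ) - ρ ≤ x := hx.1
  have hx2 : (x : ℝ) ≤ p + ρ := hx.2
  rw [abs_le]
  constructor <;> linarith

/-- Preimages under iterates depend little on the remote past. -/
theorem exists_fibIter_eq_near (h : IsBlender G) (n : ℕ) {η η₀ : Seq k} {s : ℕ}
    (hη : AgreeFrom s η η₀) {p : I} (hp : (p : ℝ) ∈ Icc (0.009 : ℝ) 0.991) :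
    ∃ x : I, G.fibIter n η x = G.fibIter n η₀ p ∧ |(x : ℝ) - p| ≤ 0.003 * 0.6 ^ s := by
  induction n generalizing η η₀ s p with
  | zero => exact ⟨p, rfl, by simp; positivity⟩
  | succ n ih =>
    obtain ⟨q, hq, hqp⟩ := ih hη.shift (h.range η₀ p)
    have hm := h.memory s η η₀ hη p
    have hpos : (0 : ℝ) < 0.6 ^ s := by positivity
    have hle : (0.6 : ℝ) ^ s ≤ 1 := pow_le_one₀ (by norm_num) (by norm_num)
    rw [pow_succ] at hqp
    -- The induction closes because 0.0004 + 0.6 · 0.003 = 0.0022 is less than 0.75 · 0.003 =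
    -- 0.00225: one more step of agreement gains more than inverting the fiber map loses.
    obtain ⟨x, hx, hxp⟩ := h.exists_fib_eq_near η (p := p) (y := q) (ρ := 0.003 * 0.6 ^ s)
      (by linarith [hp.1]) (by linarith [hp.2]) (by positivity) (by
        rw [abs_le] at *
        constructor <;> linarith [hm.1, hm.2, hqp.1, hqp.2])
    exact ⟨x, by rw [G.fibIter_succ, G.fibIter_succ, hx, hq], hxp⟩

/-- Following the past of a nondegenerate fiber of the attractor, one reaches the region in which
the fiber maps cover. -/
theorem exists_preimages_central (h : IsBlender G) {ω : Seq k} {u v : I} (hu : u ∈ G.sec ω)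
    (hv : v ∈ G.sec ω) (huv : u ≠ v) (N : ℕ) :
    ∃ n ≥ N, ∃ p q : I, p ≠ q ∧ (p : ℝ) ∈ Icc (0.11 : ℝ) 0.89 ∧ (q : ℝ) ∈ Icc (0.11 : ℝ) 0.89 ∧
      G.fibIter n (past n ω) p ∈ uIcc u v ∧ G.fibIter n (past n ω) q ∈ uIcc u v := by
  choose P hP using G.mem_sec_iff.1 hu
  choose Q hQ using G.mem_sec_iff.1 hv
  have hPQ : ∀ n, P n ≠ Q n := fun n he => huv (by rw [← hP n, ← hQ n, he])
  have hstep : ∀ (R : ℕ → I) (w : I), (∀ n, G.fibIter n (past n ω) (R n) = w) →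
      ∀ n, R n = G.fib (past (n + 1) ω) (R (n + 1)) := fun R w hR n => by
    refine G.fibIter_injective n (past n ω) ?_
    rw [hR n, ← hR (n + 1), G.fibIter_succ, shift_past_succ]
  have hPs := hstep P u hP
  have hQs := hstep Q v hQ
  by_contra hcon
  -- If the preimage interval never meets the centre in a nontrivial interval, its two ends are
  -- always on the same outer side; otherwise truncating it to [0.11, 0.89] would give a central
  -- pair.
  have hout : ∀ n ≥ N, ((P n : ℝ) ≤ 0.11 ∧ (Q n : ℝ) ≤ 0.11) ∨
      (0.89 ≤ (P n : ℝ) ∧ 0.89 ≤ (Q n : ℝ)) := by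
    intro n hn
    by_contra hc
    have key : ∀ p q : I, p < q → G.fibIter n (past n ω) p ∈ uIcc u v →
        G.fibIter n (past n ω) q ∈ uIcc u v → (0.11 : ℝ) < q → (p : ℝ) < 0.89 → False := by
      intro p q hpq hp hq h1 h2
      set c : I := ⟨0.11, by norm_num, by norm_num⟩
      set d : I := ⟨0.89, by norm_num, by norm_num⟩
      have hcd : c < d := by rw [← Subtype.coe_lt_coe]; norm_num [c, d]
      have h3 : max p c < min q d := max_lt (lt_min hpq (Subtype.coe_lt_coe.1 h2))
        (lt_min (Subtype.coe_lt_coe.1 h1) hcd)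
      have hsub : ∀ x, p ≤ x → x ≤ q → G.fibIter n (past n ω) x ∈ uIcc u v := fun x h4 h5 =>
        uIcc_subset_uIcc hp hq (mem_uIcc_of_injective (G.continuous_fibIter n _)
          (G.fibIter_injective n _) (mem_uIcc_of_le h4 h5))
      refine hcon ⟨n, hn, max p c, min q d, h3.ne, ⟨?_, ?_⟩, ⟨?_, ?_⟩,
        hsub _ (le_max_left _ _) (h3.le.trans (min_le_left _ _)),
        hsub _ ((le_max_left _ _).trans h3.le) (min_le_left _ _)⟩
      · exact Subtype.coe_le_coe.2 (le_max_right p c)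
      · exact Subtype.coe_le_coe.2 (h3.le.trans (min_le_right q d))
      · exact Subtype.coe_le_coe.2 ((le_max_right p c).trans h3.le)
      · exact Subtype.coe_le_coe.2 (min_le_right q d)
    have hpu : G.fibIter n (past n ω) (P n) ∈ uIcc u v := by rw [hP]; exact left_mem_uIcc
    have hqv : G.fibIter n (past n ω) (Q n) ∈ uIcc u v := by rw [hQ]; exact right_mem_uIcc
    rcases lt_or_gt_of_ne (hPQ n) with hlt | hlt
    · have hlt' : (P n : ℝ) < Q n := hlt
      refine key _ _ hlt hpu hqv ?_ ?_ <;> by_contra hle <;> refine hc ?_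
      · exact Or.inl ⟨by linarith, by linarith⟩
      · exact Or.inr ⟨by linarith, by linarith⟩
    · have hlt' : (Q n : ℝ) < P n := hlt
      refine key _ _ hlt hqv hpu ?_ ?_ <;> by_contra hle <;> refine hc ?_
      · exact Or.inl ⟨by linarith, by linarith⟩
      · exact Or.inr ⟨by linarith, by linarith⟩
  -- Whatever the symbol, a step whose image lies in an outer region contracts. Pulling back would
  -- then lengthen the interval geometrically forever inside `I`.
  have hcontr : ∀ n ≥ N, |(P n : ℝ) - Q n| ≤ 0.998 * |(P (n + 1) : ℝ) - Q (n + 1)| := by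
    intro n hn
    have ho := hout n hn
    rw [hPs n, hQs n] at ho ⊢
    by_cases h0 : past (n + 1) ω 0 = 0
    · rcases ho with ⟨h1, h2⟩ | ⟨h1, h2⟩
      · exact h.contract_low _ h0 _ _ (by linarith) (by linarith)
      · exact h.contract_high _ h0 _ _ (by linarith) (by linarith)
    · exact h.contract_of_ne _ h0 _ _
  have hall : ∀ j : ℕ, |(P N : ℝ) - Q N| ≤ 0.998 ^ j * |(P (N + j) : ℝ) - Q (N + j)| := by
    intro j
    induction j with
    | zero => simp
    | succ j ih =>
      refine ih.trans ?_
      rw [pow_succ, mul_assoc]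
      exact mul_le_mul_of_nonneg_left (hcontr (N + j) (by omega)) (by positivity)
  have hpos := RandomMap.abs_pos_of_ne (hPQ N)
  obtain ⟨j, hj⟩ := exists_pow_lt_of_lt_one hpos (by norm_num : (0.998 : ℝ) < 1)
  have h1 := hall j
  have h2 : (0.998 : ℝ) ^ j * |(P (N + j) : ℝ) - Q (N + j)| ≤ 0.998 ^ j :=
    mul_le_of_le_one_right (by positivity) (RandomMap.abs_sub_le_one _ _)
  linarith

end IsBlender

/-! ### The blender: pullbacks along a freely chosen past -/

namespace IsBlender

variable {k : ℕ} {G : RandomMap k} {Λ : Fin k → ℝ}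

/-- The sequence with the symbol `a` at index `0`, the symbols of `η` to the right of it, and the
symbol `b` to the left of it. -/
def prepend (a b : Fin k) (η : Seq k) : Seq k := fun i =>
  if 0 < i then η (i - 1) else if i = 0 then a else b

theorem shift_prepend (a b : Fin k) (η : Seq k) (i : ℤ) (hi : 0 ≤ i) :
    shift (prepend a b η) i = η i := by
  simp only [shift, prepend]
  rw [if_pos (by omega)]
  simp

/-- An explicit supply of graph points: a constant past with a contracting symbol. -/
theorem mem_pointSet_of_past (hL : G.LipBound Λ) (hΛ : ∀ a, 0 < Λ a) {b : Fin k}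
    (hb : Λ b < 1) {η : Seq k} (hη : ∀ i < 0, η i = b) : η ∈ G.pointSet := by
  refine hL.mem_pointSet hΛ (c := -Real.log (Λ b)) (neg_pos.2 (Real.log_neg (hΛ b) hb))
    (Eventually.of_forall fun n => ?_)
  have : ∀ j ∈ Finset.range n, Λ (η (-1 - j)) = Λ b := fun j _ => by rw [hη _ (by omega)]
  rw [Finset.prod_congr rfl this, Finset.prod_const, Finset.card_range, neg_neg,
    mul_comm, Real.exp_nat_mul, Real.exp_log (hΛ b)]

theorem exists_preimage_sec (η : Seq k) {x : I} (hx : x ∈ G.sec η) :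
    ∃ y ∈ G.sec (past 1 η), G.fib (past 1 η) y = x := by
  have h1 : shift (past 1 η) = η := shift_iterate_past 1 η
  rw [← h1, RandomMap.sec_shift] at hx
  exact hx

/-- A point of the graph in the right position over the start of a finite orbit gives a point of
the graph over its end. -/
theorem exists_graph_point {η η₀ : Seq k} (n : ℕ) (hη : ∀ i : ℤ, 0 ≤ i → η i = η₀ i)
    (hp : η ∈ G.pointSet) {p q : I} (hpq : G.lowerPoint η ∈ uIcc p q) :
    ∃ ω ∈ G.pointSet, (∀ i : ℤ, -(n : ℤ) ≤ i → ω i = shift^[n] η₀ i) ∧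
      G.lowerPoint ω ∈ uIcc (G.fibIter n η p) (G.fibIter n η q) := by
  refine ⟨shift^[n] η, ?_, fun i hi => ?_, ?_⟩
  · induction n with
    | zero => exact hp
    | succ n ih =>
      rw [Function.iterate_succ_apply']
      exact G.shift_mem_pointSet_iff.2 ih
  · rw [shift_iterate, shift_iterate]
    exact hη _ (by omega)
  · rw [← RandomMap.fibIter_lowerPoint hp]
    exact mem_uIcc_of_injective (G.continuous_fibIter n η) (G.fibIter_injective n η) hpq

theorem exists_fib_eq_of_mem (ω : Seq k) {a b y : I} (hab : a ≤ b)
    (hy : (G.fib ω a : ℝ) ≤ y ∧ (y : ℝ) ≤ G.fib ω b ∨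
      (G.fib ω b : ℝ) ≤ y ∧ (y : ℝ) ≤ G.fib ω a) :
    ∃ x : I, (x : ℝ) ∈ Icc (a : ℝ) b ∧ G.fib ω x = y := by
  obtain ⟨x, hx, hxy⟩ := exists_fib_eq (G.continuous_fib_apply ω) (a := a) (b := b) (y := y)
    (mem_uIcc.2 hy)
  rw [uIcc_of_le hab] at hx
  exact ⟨x, ⟨hx.1, hx.2⟩, hxy⟩

theorem exists_unitInterval_eq {r : ℝ} (h0 : 0 ≤ r) (h1 : r ≤ 1) : ∃ a : I, (a : ℝ) = r :=
  ⟨⟨r, h0, h1⟩, rfl⟩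

variable [NeZero k]

/-- The first landmark: 0.2 is the fixed point of `affineMap`, and errors 0.0001 per step accumulate
to 0.0001/(1 − 0.9) = 0.001. -/
theorem abs_sec_sub_le (h : IsBlender G) {b : Fin k} (hb : b ≠ 0) (n : ℕ) {η : Seq k}
    (hη : ∀ i < 0, η i = b) {x : I} (hx : x ∈ G.sec η) :
    |(x : ℝ) - 0.2| ≤ 0.9 ^ n + 0.001 := by
  induction n generalizing η x with
  | zero =>
    have := x.2.1
    have := x.2.2
    rw [abs_le]
    constructor <;> norm_num <;> linarith
  | succ n ih =>
    obtain ⟨y, hy, rfl⟩ := exists_preimage_sec η hx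
    have h0 : past 1 η 0 ≠ 0 := by
      rw [show past 1 η 0 = b from hη _ (by norm_num)]; exact hb
    have h1 := ih (η := past 1 η) (fun i hi => hη _ (by push_cast; omega)) hy
    have h2 := h.near_affine _ h0 y
    rw [affineMap] at h2
    rw [abs_le] at *
    rw [pow_succ]
    constructor <;> linarith [h1.1, h1.2, h2.1, h2.2]

theorem abs_sec_sub_le_const (h : IsBlender G) {b : Fin k} (hb : b ≠ 0) {η : Seq k}
    (hη : ∀ i < 0, η i = b) {x : I} (hx : x ∈ G.sec η) : |(x : ℝ) - 0.2| ≤ 0.002 := by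
  obtain ⟨n, hn⟩ := exists_pow_lt_of_lt_one (by norm_num : (0 : ℝ) < 0.001)
    (by norm_num : (0.9 : ℝ) < 1)
  exact (h.abs_sec_sub_le hb n hη hx).trans (by linarith)

/-- The second landmark is the image 0.8135 of 0.2 under `cubicMap`, reached by a past that ends
with the symbol `0`. -/
theorem cubicMap_near {x : ℝ} (hx : |x - 0.2| ≤ 0.002) :
    cubicMap x ∈ Icc (0.8105 : ℝ) 0.8165 := by
  rw [abs_le] at hx
  obtain ⟨t, rfl⟩ : ∃ t, x = 0.2 + t := ⟨x - 0.2, by ring⟩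
  have h1 : -0.002 ≤ t := by linarith
  have h2 : t ≤ 0.002 := by linarith
  have e : cubicMap (0.2 + t) = 0.8135 - t * (0.973 + 0.36 * t - 0.4 * t ^ 2) := by
    unfold cubicMap; ring
  have h3 : t ^ 2 ≤ 0.002 ^ 2 := sq_le_sq' (by linarith) h2
  have h4 : |t * (0.973 + 0.36 * t - 0.4 * t ^ 2)| ≤ 0.002 * 1.5 := by
    rw [abs_mul]
    refine mul_le_mul (abs_le.2 ⟨by linarith, h2⟩) ?_ (abs_nonneg _) (by norm_num)
    rw [abs_le]
    constructor <;> nlinarith [sq_nonneg t]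
  rw [abs_le] at h4
  rw [e]
  constructor <;> linarith [h4.1, h4.2]

/-- Fiber iterates are injective, so the given preimage over the modified past is the nearby one
found by `exists_fibIter_eq_near` with s = 0. -/
theorem abs_sub_le_of_agree (h : IsBlender G) {η η₀ : Seq k}
    (hη : ∀ i : ℤ, 0 ≤ i → η i = η₀ i) (n : ℕ) {p p₀ u : I}
    (hp₀ : (p₀ : ℝ) ∈ Icc (0.1 : ℝ) 0.9) (h₀ : G.fibIter n η₀ p₀ = u)
    (hp : G.fibIter n η p = u) : |(p : ℝ) - p₀| ≤ 0.003 := by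
  obtain ⟨x, hx, hxp⟩ := h.exists_fibIter_eq_near n (η := η) (η₀ := η₀) (s := 0) (p := p₀)
    (fun i hi => hη i (by simpa using hi)) ⟨by linarith [hp₀.1], by linarith [hp₀.2]⟩
  have : x = p := G.fibIter_injective n η (by rw [hx, h₀, hp])
  subst this
  simpa using hxp

/-- Together with `exists_preimage_high` and `exists_preimage_mid` this is the covering property of
the blender. The three ranges overlap and leave room for the displacement 0.003 caused by a change
of past. -/
theorem exists_preimage_low (h : IsBlender G) {ω : Seq k} (h0 : ω 0 = 0) {y : I}
    (hy : (y : ℝ) ∈ Icc (0.097 : ℝ) 0.215) :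
    ∃ x : I, (x : ℝ) ∈ Icc (0.1 : ℝ) 0.9 ∧ G.fib ω x = y := by
  obtain ⟨a, ha⟩ := exists_unitInterval_eq (r := 0.765) (by norm_num) (by norm_num)
  obtain ⟨b, hb⟩ := exists_unitInterval_eq (r := 0.9) (by norm_num) (by norm_num)
  have hab : a ≤ b := Subtype.coe_le_coe.1 (by rw [ha, hb]; norm_num)
  have h1 := abs_le.1 (h.near_cubic ω h0 a)
  have h2 := abs_le.1 (h.near_cubic ω h0 b)
  rw [ha] at h1
  rw [hb] at h2
  norm_num [cubicMap] at h1 h2 hy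
  obtain ⟨x, hx, hxy⟩ := exists_fib_eq_of_mem (G := G) ω (y := y) hab
    (Or.inr ⟨by linarith [h1.2, h2.2], by linarith [h1.1, h2.1]⟩)
  rw [ha, hb] at hx
  exact ⟨x, ⟨by linarith [hx.1], by linarith [hx.2]⟩, hxy⟩

theorem exists_preimage_high (h : IsBlender G) {ω : Seq k} (h0 : ω 0 = 0) {y : I}
    (hy : (y : ℝ) ∈ Icc (0.785 : ℝ) 0.903) :
    ∃ x : I, (x : ℝ) ∈ Icc (0.1 : ℝ) 0.9 ∧ G.fib ω x = y := by
  obtain ⟨a, ha⟩ := exists_unitInterval_eq (r := 0.1) (by norm_num) (by norm_num)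
  obtain ⟨b, hb⟩ := exists_unitInterval_eq (r := 0.235) (by norm_num) (by norm_num)
  have hab : a ≤ b := Subtype.coe_le_coe.1 (by rw [ha, hb]; norm_num)
  have h1 := abs_le.1 (h.near_cubic ω h0 a)
  have h2 := abs_le.1 (h.near_cubic ω h0 b)
  rw [ha] at h1
  rw [hb] at h2
  norm_num [cubicMap] at h1 h2 hy
  obtain ⟨x, hx, hxy⟩ := exists_fib_eq_of_mem (G := G) ω (y := y) hab
    (Or.inr ⟨by linarith [h1.2, h2.2], by linarith [h1.1, h2.1]⟩)
  rw [ha, hb] at hx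
  exact ⟨x, ⟨by linarith [hx.1], by linarith [hx.2]⟩, hxy⟩

theorem exists_preimage_mid (h : IsBlender G) {ω : Seq k} (h0 : ω 0 ≠ 0) {y : I}
    (hy : (y : ℝ) ∈ Icc (0.175 : ℝ) 0.825) :
    ∃ x : I, (x : ℝ) ∈ Icc (0.1 : ℝ) 0.9 ∧ G.fib ω x = y := by
  obtain ⟨a, ha⟩ := exists_unitInterval_eq (r := 0.1) (by norm_num) (by norm_num)
  obtain ⟨b, hb⟩ := exists_unitInterval_eq (r := 0.9) (by norm_num) (by norm_num)
  have hab : a ≤ b := Subtype.coe_le_coe.1 (by rw [ha, hb]; norm_num)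
  have h1 := abs_le.1 (h.near_affine ω h0 a)
  have h2 := abs_le.1 (h.near_affine ω h0 b)
  rw [ha] at h1
  rw [hb] at h2
  norm_num [affineMap] at h1 h2 hy
  obtain ⟨x, hx, hxy⟩ := exists_fib_eq_of_mem (G := G) ω (y := y) hab
    (Or.inl ⟨by linarith [h1.2, h2.2], by linarith [h1.1, h2.1]⟩)
  rw [ha, hb] at hx
  exact ⟨x, ⟨by linarith [hx.1], by linarith [hx.2]⟩, hxy⟩

/-- If, for every past, the preimages of `u` and `v` under `n` steps lie in the covering region and
are a definite distance apart, then the graph passes between `u` and `v` over some past. -/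
theorem exists_graph_between (h : IsBlender G) (hL : G.LipBound Λ) (hΛ : ∀ a, 0 < Λ a) {b : Fin k}
    (hb0 : b ≠ 0) (hb : Λ b < 1) (m : ℕ) (n : ℕ) (η₀ : Seq k) (u v : I)
    (H : ∀ η : Seq k, (∀ i : ℤ, 0 ≤ i → η i = η₀ i) → ∃ p q : I, (p : ℝ) ∈ Icc (0.1 : ℝ) 0.9 ∧
      (q : ℝ) ∈ Icc (0.1 : ℝ) 0.9 ∧ G.fibIter n η p = u ∧ G.fibIter n η q = v ∧
      0.998 ^ m ≤ |(p : ℝ) - q|) :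
    ∃ ω ∈ G.pointSet, (∀ i : ℤ, -(n : ℤ) ≤ i → ω i = shift^[n] η₀ i) ∧
      G.lowerPoint ω ∈ uIcc u v := by
  induction m generalizing n η₀ with
  -- Length 1 is impossible inside [0.1, 0.9]; this is where the pullbacks must have stopped.
  | zero =>
    obtain ⟨p, q, hp, hq, -, -, h1⟩ := H η₀ fun _ _ => rfl
    have : |(p : ℝ) - q| ≤ 0.8 := abs_le.2 ⟨by linarith [hp.1, hq.2], by linarith [hp.2, hq.1]⟩
    norm_num at h1 this
    linarith
  | succ m ih =>
    obtain ⟨p₀, q₀, hp₀, hq₀, hu, hv, -⟩ := H η₀ fun _ _ => rfl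
    -- prepending a symbol whose fiber maps have contracting preimages of all strips
    have step : ∀ a : Fin k, (∀ (ω : Seq k) (p q : I), ω 0 = a → |(p : ℝ) - p₀| ≤ 0.003 →
        |(q : ℝ) - q₀| ≤ 0.003 → (∃ x : I, (x : ℝ) ∈ Icc (0.1 : ℝ) 0.9 ∧ G.fib ω x = p) ∧
        (∃ x : I, (x : ℝ) ∈ Icc (0.1 : ℝ) 0.9 ∧ G.fib ω x = q) ∧
        ∀ x y : I, G.fib ω x = p → G.fib ω y = q → |(p : ℝ) - q| ≤ 0.998 * |(x : ℝ) - y|) →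
        ∃ ω ∈ G.pointSet, (∀ i : ℤ, -(n : ℤ) ≤ i → ω i = shift^[n] η₀ i) ∧
          G.lowerPoint ω ∈ uIcc u v := by
      intro a ha
      obtain ⟨ω, hω, hωi, hωu⟩ := ih (n + 1) (prepend a b η₀) (fun η hη => by
        have hs : ∀ i : ℤ, 0 ≤ i → shift η i = η₀ i := fun i hi => by
          rw [← shift_prepend a b η₀ i hi]
          exact hη (i + 1) (by omega)
        obtain ⟨p, q, hp, hq, hpu, hqv, hlen⟩ := H (shift η) hs
        have h0 : η 0 = a := by rw [hη 0 le_rfl]; simp [prepend]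
        obtain ⟨⟨x, hx, hxp⟩, ⟨y, hy, hyq⟩, hxy⟩ := ha η p q h0
          (h.abs_sub_le_of_agree hs n hp₀ hu hpu) (h.abs_sub_le_of_agree hs n hq₀ hv hqv)
        refine ⟨x, y, hx, hy, by rw [G.fibIter_succ, hxp, hpu], by rw [G.fibIter_succ, hyq, hqv],
          ?_⟩
        have := hxy x y hxp hyq
        rw [pow_succ] at hlen
        linarith)
      refine ⟨ω, hω, fun i hi => ?_, hωu⟩
      rw [hωi i (by push_cast; omega), shift_iterate, shift_iterate]
      simp only [prepend]
      rw [if_pos (by push_cast; omega)]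
      congr 1
      push_cast
      ring
    -- points of the graph over suitable pasts
    have final : ∀ η : Seq k, (∀ i : ℤ, 0 ≤ i → η i = η₀ i) → η ∈ G.pointSet →
        (∀ p q : I, |(p : ℝ) - p₀| ≤ 0.003 → |(q : ℝ) - q₀| ≤ 0.003 →
          G.lowerPoint η ∈ uIcc p q) →
        ∃ ω ∈ G.pointSet, (∀ i : ℤ, -(n : ℤ) ≤ i → ω i = shift^[n] η₀ i) ∧
          G.lowerPoint ω ∈ uIcc u v := by
      intro η hη hηp hmem
      obtain ⟨p, q, hp, hq, hpu, hqv, -⟩ := H η hη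
      have := exists_graph_point n hη hηp (hmem p q (h.abs_sub_le_of_agree hη n hp₀ hu hpu)
        (h.abs_sub_le_of_agree hη n hq₀ hv hqv))
      rwa [hpu, hqv] at this
    -- Over the past consisting of `b` only, the graph is within 0.002 of 0.2, hence inside the
    -- straddled gap [0.18, 0.21] even after its ends move by 0.003.
    have caseLow : (p₀ : ℝ) < 0.18 ∧ 0.21 < (q₀ : ℝ) ∨ (q₀ : ℝ) < 0.18 ∧ 0.21 < (p₀ : ℝ) →
        ∃ ω ∈ G.pointSet, (∀ i : ℤ, -(n : ℤ) ≤ i → ω i = shift^[n] η₀ i) ∧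
          G.lowerPoint ω ∈ uIcc u v := by
      intro hc
      set η : Seq k := fun i => if 0 ≤ i then η₀ i else b with hη
      have hpast : ∀ i < 0, η i = b := fun i hi => if_neg (not_le.2 hi)
      have hγ := abs_le.1 (h.abs_sec_sub_le_const hb0 hpast (G.lowerPoint_mem η))
      refine final η (fun i hi => if_pos hi) (mem_pointSet_of_past hL hΛ hb hpast)
        fun p q hp hq => ?_
      rw [abs_le] at hp hq
      refine mem_uIcc.2 (hc.imp (fun hc => ⟨?_, ?_⟩) (fun hc => ⟨?_, ?_⟩)) <;>
        refine Subtype.coe_le_coe.1 ?_ <;>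
        linarith [hp.1, hp.2, hq.1, hq.2, hγ.1, hγ.2, hc.1, hc.2]
    have caseHigh : (p₀ : ℝ) < 0.79 ∧ 0.82 < (q₀ : ℝ) ∨ (q₀ : ℝ) < 0.79 ∧ 0.82 < (p₀ : ℝ) →
        ∃ ω ∈ G.pointSet, (∀ i : ℤ, -(n : ℤ) ≤ i → ω i = shift^[n] η₀ i) ∧
          G.lowerPoint ω ∈ uIcc u v := by
      intro hc
      -- The past is `0` at index −1 and `b` before it, so the graph point lies within 0.0001 of
      -- [0.8105, 0.8165], inside [0.793, 0.817].
      set η : Seq k := shift (prepend 0 b η₀) with hη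
      have hpast : ∀ i < 0, prepend 0 b η₀ i = b := fun i hi => by
        simp only [prepend]
        rw [if_neg (by omega), if_neg (by omega)]
      have hpt := mem_pointSet_of_past hL hΛ hb hpast
      have h1 := h.abs_sec_sub_le_const hb0 hpast (G.lowerPoint_mem _)
      have h2 := cubicMap_near h1
      have h3 := abs_le.1 (h.near_cubic (prepend 0 b η₀) (by simp [prepend])
        (G.lowerPoint (prepend 0 b η₀)))
      rw [G.fib_lowerPoint hpt] at h3
      refine final η (shift_prepend 0 b η₀) (G.shift_mem_pointSet_iff.2 hpt)
        fun p q hp hq => ?_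
      rw [abs_le] at hp hq
      refine mem_uIcc.2 (hc.imp (fun hc => ⟨?_, ?_⟩) (fun hc => ⟨?_, ?_⟩)) <;>
        refine Subtype.coe_le_coe.1 ?_ <;>
        linarith [hp.1, hp.2, hq.1, hq.2, h3.1, h3.2, h2.1, h2.2, hc.1, hc.2]
    -- The windows [0.1, 0.21], [0.18, 0.82] and [0.79, 0.9] overlap. A pair contained in one of
    -- them is pulled back by the symbol of that window; a pair contained in none straddles [0.18,
    -- 0.21] or [0.79, 0.82].
    by_cases hA : (p₀ : ℝ) ≤ 0.21 ∧ (q₀ : ℝ) ≤ 0.21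
    · refine step 0 fun ω p q h0 hp hq => ?_
      rw [abs_le] at hp hq
      have hp1 : (p : ℝ) ∈ Icc (0.097 : ℝ) 0.215 := ⟨by linarith [hp₀.1], by linarith [hA.1]⟩
      have hq1 : (q : ℝ) ∈ Icc (0.097 : ℝ) 0.215 := ⟨by linarith [hq₀.1], by linarith [hA.2]⟩
      refine ⟨h.exists_preimage_low h0 hp1, h.exists_preimage_low h0 hq1, ?_⟩
      rintro x y rfl rfl
      exact h.contract_low ω h0 x y hp1.2 hq1.2
    by_cases hB : 0.79 ≤ (p₀ : ℝ) ∧ 0.79 ≤ (q₀ : ℝ)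
    · refine step 0 fun ω p q h0 hp hq => ?_
      rw [abs_le] at hp hq
      have hp1 : (p : ℝ) ∈ Icc (0.785 : ℝ) 0.903 := ⟨by linarith [hB.1], by linarith [hp₀.2]⟩
      have hq1 : (q : ℝ) ∈ Icc (0.785 : ℝ) 0.903 := ⟨by linarith [hB.2], by linarith [hq₀.2]⟩
      refine ⟨h.exists_preimage_high h0 hp1, h.exists_preimage_high h0 hq1, ?_⟩
      rintro x y rfl rfl
      exact h.contract_high ω h0 x y hp1.1 hq1.1
    by_cases hC : (p₀ : ℝ) ∈ Icc (0.18 : ℝ) 0.82 ∧ (q₀ : ℝ) ∈ Icc (0.18 : ℝ) 0.82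
    · refine step b fun ω p q h0 hp hq => ?_
      rw [abs_le] at hp hq
      have h0' : ω 0 ≠ 0 := by rw [h0]; exact hb0
      have hp1 : (p : ℝ) ∈ Icc (0.175 : ℝ) 0.825 := ⟨by linarith [hC.1.1], by linarith [hC.1.2]⟩
      have hq1 : (q : ℝ) ∈ Icc (0.175 : ℝ) 0.825 := ⟨by linarith [hC.2.1], by linarith [hC.2.2]⟩
      refine ⟨h.exists_preimage_mid h0' hp1, h.exists_preimage_mid h0' hq1, ?_⟩
      rintro x y rfl rfl
      exact h.contract_of_ne ω h0' x y
    by_cases hlow : (p₀ : ℝ) < 0.18 ∨ (q₀ : ℝ) < 0.18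
    · refine caseLow (hlow.imp (fun h1 => ⟨h1, ?_⟩) fun h1 => ⟨h1, ?_⟩) <;> by_contra hle <;>
        exact hA ⟨by linarith, by linarith⟩
    · have hlow' := not_or.1 hlow
      have hhigh : (q₀ : ℝ) > 0.82 ∨ (p₀ : ℝ) > 0.82 := by
        by_contra hcon
        have hcon' := not_or.1 hcon
        exact hC ⟨⟨by linarith [hlow'.1], by linarith [hcon'.2]⟩,
          ⟨by linarith [hlow'.2], by linarith [hcon'.1]⟩⟩
      refine caseHigh (hhigh.imp (fun h1 => ⟨?_, h1⟩) fun h1 => ⟨?_, h1⟩) <;> by_contra hle <;>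
        exact hB ⟨by linarith, by linarith⟩

theorem exists_graph_near (h : IsBlender G) (hL : G.LipBound Λ) (hΛ : ∀ a, 0 < Λ a) {b : Fin k}
    (hb0 : b ≠ 0) (hb : Λ b < 1) {ω : Seq k} {u v : I} (hu : u ∈ G.sec ω) (hv : v ∈ G.sec ω)
    (huv : u ≠ v) (N : ℕ) :
    ∃ ω' ∈ G.pointSet, AgreeFrom N ω' ω ∧ G.lowerPoint ω' ∈ uIcc u v := by
  obtain ⟨n, hn, p₀, q₀, hpq, hp₀, hq₀, hp, hq⟩ := h.exists_preimages_central hu hv huv N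
  set η₀ := past n ω with hη₀
  set u' := G.fibIter n η₀ p₀ with hu'
  set v' := G.fibIter n η₀ q₀ with hv'
  set P : ℝ := 1 + ∑ a, Λ a with hP
  have hP0 : 0 < P := add_pos_of_pos_of_nonneg one_pos (Finset.sum_nonneg fun a _ => (hΛ a).le)
  have hPn : 0 < P ^ n := pow_pos hP0 n
  have huv' : 0 < |(u' : ℝ) - v'| :=
    RandomMap.abs_pos_of_ne ((G.fibIter_injective n η₀).ne hpq)
  -- The forward Lipschitz bound P^n holds for every past, so preimages of `u'` and `v'` stay at
  -- least |u' − v'|/P^n apart uniformly in the past; `m` bounds the number of further pullbacks.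
  obtain ⟨m, hm⟩ := exists_pow_lt_of_lt_one (div_pos huv' hPn) (by norm_num : (0.998 : ℝ) < 1)
  obtain ⟨ω', hω', hag, hmem⟩ := h.exists_graph_between hL hΛ hb0 hb m n η₀ u' v' fun η hη => by
    -- Changing the past moves the preimages by at most 0.003, so they pass from [0.11, 0.89] into
    -- [0.1, 0.9] at worst.
    have hag : AgreeFrom 0 η η₀ := fun i hi => hη i (by simpa using hi)
    obtain ⟨p, hpe, hpn⟩ := h.exists_fibIter_eq_near n hag (p := p₀)
      ⟨by linarith [hp₀.1], by linarith [hp₀.2]⟩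
    obtain ⟨q, hqe, hqn⟩ := h.exists_fibIter_eq_near n hag (p := q₀)
      ⟨by linarith [hq₀.1], by linarith [hq₀.2]⟩
    rw [pow_zero, mul_one, abs_le] at hpn hqn
    refine ⟨p, q, ⟨by linarith [hp₀.1, hpn.1], by linarith [hp₀.2, hpn.2]⟩,
      ⟨by linarith [hq₀.1, hqn.1], by linarith [hq₀.2, hqn.2]⟩, hpe, hqe, hm.le.trans ?_⟩
    rw [div_le_iff₀ hPn, hu', hv', ← hpe, ← hqe, mul_comm]
    refine (hL.fibIter hΛ n η p q).trans (mul_le_mul_of_nonneg_right ?_ (abs_nonneg _))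
    calc ∏ j ∈ Finset.range n, Λ (η j) ≤ ∏ _j ∈ Finset.range n, P :=
          Finset.prod_le_prod (fun j _ => (hΛ _).le) fun j _ =>
            (Finset.single_le_sum (f := Λ) (fun a _ => (hΛ a).le) (Finset.mem_univ _)).trans
              (le_add_of_nonneg_left zero_le_one)
      _ = P ^ n := by simp
  refine ⟨ω', hω', fun i hi => ?_, uIcc_subset_uIcc hp hq hmem⟩
  rw [hag i (by omega), hη₀, shift_iterate_past]

theorem bone_subset_closure (h : IsBlender G) (hL : G.LipBound Λ) (hΛ : ∀ a, 0 < Λ a) {b : Fin k}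
    (hb0 : b ≠ 0) (hb : Λ b < 1) {ω : Seq k} (hω : ω ∉ G.pointSet) {x : I} (hx : x ∈ G.sec ω) :
    (ω, x) ∈ closure (graphOver G.pointSet G.lowerPoint) := by
  obtain ⟨y, hy, hyx⟩ : ∃ y ∈ G.sec ω, y ≠ x := by
    by_contra hcon
    refine hω fun a ha c hc => ?_
    push Not at hcon
    rw [hcon a ha, hcon c hc]
  rw [mem_closure_iff_nhds]
  intro V hV
  obtain ⟨V₁, hV₁, V₂, hV₂, hV12⟩ := mem_nhds_prod_iff.1 hV
  -- the base
  obtain ⟨s, t, hst, htV⟩ := isOpen_pi_iff.1 isOpen_interior ω (mem_interior_iff_mem_nhds.2 hV₁)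
  obtain ⟨N, hN⟩ : ∃ N : ℕ, ∀ i ∈ s, -(N : ℤ) ≤ i := by
    refine ⟨s.sup Int.natAbs, fun i hi => ?_⟩
    have := Finset.le_sup (f := Int.natAbs) hi
    omega
  -- the fiber
  obtain ⟨ε, hε, hball⟩ := Metric.mem_nhds_iff.1 hV₂
  -- Shrinks the fiber segment from `x` towards `y` to length below ε; any graph point found between
  -- its ends is then close to `x`.
  set c : ℝ := min 1 (ε / 2) with hc
  have hc0 : 0 < c := lt_min one_pos (half_pos hε)
  have hc1 : c ≤ 1 := min_le_left _ _
  have hvI : (x : ℝ) + c * (y - x) ∈ Icc (0 : ℝ) 1 := by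
    have h1 := x.2.1
    have h2 := x.2.2
    have h3 := y.2.1
    have h4 := y.2.2
    constructor <;> nlinarith
  set v : I := ⟨x + c * (y - x), hvI⟩ with hv
  have hvx : (v : ℝ) - x = c * (y - x) := by simp [hv]
  have hne : x ≠ v := by
    intro he
    rw [← he, sub_self] at hvx
    exact hyx (Subtype.ext (sub_eq_zero.1 ((mul_eq_zero.1 hvx.symm).resolve_left hc0.ne')))
  have hvmem : v ∈ uIcc x y := by
    rcases le_total x y with hxy | hxy
    · have hxy' : (x : ℝ) ≤ y := hxy
      exact mem_uIcc.2 (Or.inl ⟨Subtype.coe_le_coe.1 (by nlinarith),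
        Subtype.coe_le_coe.1 (by nlinarith)⟩)
    · have hxy' : (y : ℝ) ≤ x := hxy
      exact mem_uIcc.2 (Or.inr ⟨Subtype.coe_le_coe.1 (by nlinarith),
        Subtype.coe_le_coe.1 (by nlinarith)⟩)
  have hvsec : v ∈ G.sec ω := (G.ordConnected_sec ω).uIcc_subset hx hy hvmem
  obtain ⟨ω', hω', hag, hmem⟩ := h.exists_graph_near hL hΛ hb0 hb hx hvsec hne N
  refine ⟨(ω', G.lowerPoint ω'), hV12 ⟨?_, hball ?_⟩, hω', rfl⟩
  · refine interior_subset (htV fun i hi => ?_)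
    change ω' i ∈ t i
    rw [hag i (hN i hi)]
    exact (hst i hi).2
  · rw [Metric.mem_ball]
    have h1 : |(G.lowerPoint ω' : ℝ) - x| ≤ |(v : ℝ) - x| := by
      rcases mem_uIcc.1 hmem with ⟨h1, h2⟩ | ⟨h1, h2⟩
      · have h1' : (x : ℝ) ≤ G.lowerPoint ω' := h1
        have h2' : (G.lowerPoint ω' : ℝ) ≤ v := h2
        exact abs_le_abs_of_nonneg (by linarith) (by linarith)
      · have h1' : (v : ℝ) ≤ G.lowerPoint ω' := h1
        have h2' : (G.lowerPoint ω' : ℝ) ≤ x := h2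
        exact abs_le_abs_of_nonpos (by linarith) (by linarith)
    have h2 : |(v : ℝ) - x| ≤ c := by
      rw [hvx, abs_mul, abs_of_pos hc0]
      exact mul_le_of_le_one_right hc0.le (RandomMap.abs_sub_le_one y x)
    have h3 : c ≤ ε / 2 := min_le_right _ _
    change |(G.lowerPoint ω' : ℝ) - x| < ε
    linarith

end IsBlender

/-! ### The model step skew product -/

section ModelMaps

/-- The derivative of `cubicMap`. -/
def cubicDeriv (x : ℝ) : ℝ := 1.2 * (x - 1 / 2) ^ 2 - 1.081

theorem hasDerivAt_cubicMap (x : ℝ) : HasDerivAt cubicMap (cubicDeriv x) x := by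
  have h1 : HasDerivAt (fun y : ℝ => y - 1 / 2) 1 x := (hasDerivAt_id x).sub_const _
  have h2 := ((h1.const_mul 1.081).sub ((h1.pow 3).const_mul 0.4)).const_sub (1 / 2)
  refine h2.congr_deriv ?_
  simp only [cubicDeriv]
  norm_num
  ring

theorem hasDerivAt_cubicDeriv (x : ℝ) : HasDerivAt cubicDeriv (2.4 * (x - 1 / 2)) x := by
  have h1 : HasDerivAt (fun y : ℝ => y - 1 / 2) 1 x := (hasDerivAt_id x).sub_const _
  have h2 := ((h1.pow 2).const_mul 1.2).sub_const 1.081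
  refine h2.congr_deriv ?_
  norm_num
  ring

theorem hasDerivAt_affineMap (x : ℝ) : HasDerivAt affineMap 0.9 x := by
  have h := ((hasDerivAt_id x).const_mul 0.9).const_add 0.02
  exact h.congr_deriv (by norm_num)

theorem cubicDeriv_mem {x : ℝ} (hx : x ∈ Icc (0 : ℝ) 1) :
    cubicDeriv x ∈ Icc (-1.081 : ℝ) (-0.781) := by
  have h : (x - 1 / 2) ^ 2 ≤ (1 / 2) ^ 2 := sq_le_sq' (by linarith [hx.1]) (by linarith [hx.2])
  unfold cubicDeriv
  constructor <;> nlinarith [sq_nonneg (x - 1 / 2)]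

theorem cubicMap_antitoneOn : AntitoneOn cubicMap (Icc 0 1) := by
  intro x hx y hy hxy
  have e : cubicMap x - cubicMap y = (y - x) * (1.081 - 0.4 * ((x - 1 / 2) ^ 2 +
      (x - 1 / 2) * (y - 1 / 2) + (y - 1 / 2) ^ 2)) := by
    unfold cubicMap; ring
  have h1 : (x - 1 / 2) ^ 2 ≤ (1 / 2) ^ 2 := sq_le_sq' (by linarith [hx.1]) (by linarith [hx.2])
  have h2 : (y - 1 / 2) ^ 2 ≤ (1 / 2) ^ 2 := sq_le_sq' (by linarith [hy.1]) (by linarith [hy.2])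
  have h3 : 0 ≤ (y - x) * (1.081 - 0.4 * ((x - 1 / 2) ^ 2 +
      (x - 1 / 2) * (y - 1 / 2) + (y - 1 / 2) ^ 2)) :=
    mul_nonneg (by linarith) (by nlinarith [sq_nonneg (x - y)])
  linarith

theorem cubicMap_mem {x : ℝ} (hx : x ∈ Icc (0 : ℝ) 1) : cubicMap x ∈ Icc (0.0095 : ℝ) 0.9905 := by
  have h0 := cubicMap_antitoneOn ⟨le_rfl, zero_le_one⟩ hx hx.1
  have h1 := cubicMap_antitoneOn hx ⟨zero_le_one, le_rfl⟩ hx.2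
  have e0 : cubicMap 0 = 0.9905 := by norm_num [cubicMap]
  have e1 : cubicMap 1 = 0.0095 := by norm_num [cubicMap]
  exact ⟨by linarith, by linarith⟩

theorem affineMap_mem {x : ℝ} (hx : x ∈ Icc (0 : ℝ) 1) : affineMap x ∈ Icc (0.02 : ℝ) 0.92 := by
  unfold affineMap
  constructor <;> linarith [hx.1, hx.2]

/-- Difference quotients of a function on the unit interval, by the mean value theorem. -/
theorem exists_derivWithin_eq {g : ℝ → ℝ} (hg : DifferentiableOn ℝ g (Icc 0 1)) {x y : ℝ}
    (hx : x ∈ Icc (0 : ℝ) 1) (hy : y ∈ Icc (0 : ℝ) 1) :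
    ∃ ξ ∈ uIcc x y, g x - g y = derivWithin g (Icc 0 1) ξ * (x - y) := by
  have key : ∀ x y : ℝ, x ∈ Icc (0 : ℝ) 1 → y ∈ Icc (0 : ℝ) 1 → x < y →
      ∃ ξ ∈ Icc x y, g x - g y = derivWithin g (Icc 0 1) ξ * (x - y) := by
    intro x y hx hy hxy
    have hsub : Icc x y ⊆ Icc 0 1 := Icc_subset_Icc hx.1 hy.2
    obtain ⟨ξ, hξ, he⟩ := exists_hasDerivAt_eq_slope g (derivWithin g (Icc 0 1)) hxy
      (hg.continuousOn.mono hsub) fun z hz =>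
        ((hg z (hsub (Ioo_subset_Icc_self hz))).hasDerivWithinAt).hasDerivAt
          (Icc_mem_nhds (hx.1.trans_lt hz.1) (hz.2.trans_le hy.2))
    refine ⟨ξ, Ioo_subset_Icc_self hξ, ?_⟩
    rw [he]
    have : y - x ≠ 0 := by linarith
    field_simp
    ring
  rcases lt_trichotomy x y with h | rfl | h
  · obtain ⟨ξ, hξ, he⟩ := key x y hx hy h
    exact ⟨ξ, by rwa [uIcc_of_le h.le], he⟩
  · exact ⟨x, left_mem_uIcc, by simp⟩
  · obtain ⟨ξ, hξ, he⟩ := key y x hy hx h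
    exact ⟨ξ, by rwa [uIcc_of_ge h.le], by linarith⟩

theorem iteratedDerivWithin_of_eqOn {g p p₁ p₂ : ℝ → ℝ} (hg : EqOn g p (Icc 0 1))
    (hp : ∀ x, HasDerivAt p (p₁ x) x) (hp₁ : ∀ x, HasDerivAt p₁ (p₂ x) x) {x : ℝ}
    (hx : x ∈ Icc (0 : ℝ) 1) : derivWithin g (Icc 0 1) x = p₁ x ∧
      iteratedDerivWithin 1 g (Icc 0 1) x = p₁ x ∧ iteratedDerivWithin 2 g (Icc 0 1) x = p₂ x := by
  have hu := uniqueDiffOn_Icc (zero_lt_one (α := ℝ))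
  have h1 : ∀ x ∈ Icc (0 : ℝ) 1, derivWithin g (Icc 0 1) x = p₁ x := fun x hx =>
    ((hp x).hasDerivWithinAt.congr hg (hg hx)).derivWithin (hu x hx)
  refine ⟨h1 x hx, by rw [iteratedDerivWithin_one, h1 x hx], ?_⟩
  rw [iteratedDerivWithin_succ]
  have h2 : EqOn (iteratedDerivWithin 1 g (Icc 0 1)) p₁ (Icc 0 1) := fun y hy => by
    rw [iteratedDerivWithin_one, h1 y hy]
  exact ((hp₁ x).hasDerivWithinAt.congr h2 (h2 hx)).derivWithin (hu x hx)

theorem eqOn_lift {f : I → I} {p : ℝ → ℝ} (h : ∀ x : I, (f x : ℝ) = p x) :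
    EqOn (lift f) p (Icc 0 1) := fun x hx => by
  have := lift_coe f ⟨x, hx⟩
  rw [h] at this
  exact this

theorem isC2Diffeo_of_model {f : I → I} {p p₁ p₂ : ℝ → ℝ} (h : ∀ x : I, (f x : ℝ) = p x)
    (hc : ContDiff ℝ 2 p) (hp : ∀ x, HasDerivAt p (p₁ x) x) (hp₁ : ∀ x, HasDerivAt p₁ (p₂ x) x)
    (hne : ∀ x ∈ Icc (0 : ℝ) 1, p₁ x ≠ 0) : IsC2Diffeo f := by
  have he := eqOn_lift h
  refine ⟨fun x y hxy => ?_, hc.contDiffOn.congr he, fun x hx => ?_⟩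
  · obtain ⟨ξ, hξ, hd⟩ := exists_derivWithin_eq (g := p)
      (fun z _ => (hp z).differentiableAt.differentiableWithinAt) x.2 y.2
    have hξI : ξ ∈ Icc (0 : ℝ) 1 := uIcc_subset_Icc x.2 y.2 hξ
    rw [← h, ← h, hxy, sub_self,
      (iteratedDerivWithin_of_eqOn (fun _ _ => rfl) hp hp₁ hξI).1] at hd
    exact Subtype.ext (sub_eq_zero.1 ((mul_eq_zero.1 hd.symm).resolve_left (hne ξ hξI)))
  · rw [(iteratedDerivWithin_of_eqOn he hp hp₁ hx).1]
    exact hne x hx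

/-- The derivative of the fiber map over `ω`. -/
def fibDeriv {k : ℕ} (G : RandomMap k) (ω : Seq k) (x : ℝ) : ℝ := derivWithin (lift (G.fib ω)) (Icc 0 1) x

theorem exists_fibDeriv_eq {k : ℕ} (G : RandomMap k) (ω : Seq k) (x y : I) :
    ∃ ξ ∈ uIcc (x : ℝ) y, (G.fib ω x : ℝ) - G.fib ω y = fibDeriv G ω ξ * ((x : ℝ) - y) := by
  have := exists_derivWithin_eq ((G.diffeo ω).contDiffOn.differentiableOn (by norm_num)) x.2 y.2
  rwa [lift_coe, lift_coe] at this

end ModelMaps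

section Model

variable {k : ℕ} [NeZero k]

/-- The fiber map of the model for the symbol `a`. -/
def modelFiber (a : Fin k) (x : I) : I :=
  if a = 0 then ⟨cubicMap x, by
    have := cubicMap_mem x.2
    exact ⟨by linarith [this.1], by linarith [this.2]⟩⟩
  else ⟨affineMap x, by
    have := affineMap_mem x.2
    exact ⟨by linarith [this.1], by linarith [this.2]⟩⟩

theorem modelFiber_zero (x : I) : (modelFiber (0 : Fin k) x : ℝ) = cubicMap x := by
  simp [modelFiber]

theorem modelFiber_of_ne {a : Fin k} (ha : a ≠ 0) (x : I) :
    (modelFiber a x : ℝ) = affineMap x := by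
  simp [modelFiber, ha]

theorem contDiff_cubicMap : ContDiff ℝ 2 cubicMap := by
  unfold cubicMap; fun_prop

theorem contDiff_affineMap : ContDiff ℝ 2 affineMap := by
  unfold affineMap; fun_prop

theorem continuous_modelFiber (a : Fin k) : Continuous (modelFiber a) := by
  refine continuous_induced_rng.2 ?_
  by_cases h : a = 0
  · subst h
    exact (contDiff_cubicMap.continuous.comp continuous_subtype_val).congr fun x =>
      (modelFiber_zero x).symm
  · exact (contDiff_affineMap.continuous.comp continuous_subtype_val).congr fun x =>
      (modelFiber_of_ne h x).symm

theorem isC2Diffeo_modelFiber (a : Fin k) : IsC2Diffeo (modelFiber a) := by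
  by_cases h : a = 0
  · subst h
    refine isC2Diffeo_of_model modelFiber_zero contDiff_cubicMap hasDerivAt_cubicMap
      hasDerivAt_cubicDeriv fun x hx h0 => ?_
    have := (cubicDeriv_mem hx).2
    rw [h0] at this
    norm_num at this
  · exact isC2Diffeo_of_model (modelFiber_of_ne h) contDiff_affineMap hasDerivAt_affineMap
      (fun x => hasDerivAt_const x 0.9) fun x hx => by norm_num

variable (k) in
/-- The model: the step skew product with fiber maps `cubicMap` and `affineMap`. -/
def model : RandomMap k where
  fib ω := modelFiber (ω 0)
  continuous_fib := by
    have h : Continuous fun z : Fin k × I => modelFiber z.1 z.2 :=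
      continuous_prod_of_discrete_left.2 continuous_modelFiber
    have h0 : Continuous fun z : Seq k × I => (z.1 0, z.2) :=
      ((continuous_apply 0).comp continuous_fst).prodMk continuous_snd
    exact h.comp h0
  diffeo ω := isC2Diffeo_modelFiber (ω 0)

theorem c2Dist_self (f : I → I) : c2Dist f f = 0 := by
  simp [c2Dist]

theorem c2Dist_triangle (f g h : I → I) : c2Dist f h ≤ c2Dist f g + c2Dist g h := by
  refine iSup₂_le fun x hx => iSup₂_le fun j hj => ?_
  refine le_trans ?_ (add_le_add (ofReal_iteratedDerivWithin_sub_le f g hj hx)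
    (ofReal_iteratedDerivWithin_sub_le g h hj hx))
  rw [← ENNReal.ofReal_add (abs_nonneg _) (abs_nonneg _)]
  exact ENNReal.ofReal_le_ofReal (abs_sub_le _ _ _)

variable (k) in
/-- The random maps whose fiber maps are uniformly `δ`-close to those of the model. -/
def modelNhd (δ : ℝ) : Set (RandomMap k) :=
  {G | ⨆ ω, c2Dist ((model k).fib ω) (G.fib ω) < ENNReal.ofReal δ}

theorem model_mem_modelNhd {δ : ℝ} (hδ : 0 < δ) : model k ∈ modelNhd k δ := by
  simp only [modelNhd, mem_ofPred_eq, c2Dist_self, ciSup_const]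
  exact ENNReal.ofReal_pos.2 hδ

/-- The distance of random maps dominates the forward C² distance, so a neighbourhood defined
without the inverses is still open. -/
theorem isOpenC2_modelNhd (δ : ℝ) : IsOpenC2 (modelNhd k δ) := by
  intro F hF
  refine ⟨ENNReal.ofReal δ - ⨆ ω, c2Dist ((model k).fib ω) (F.fib ω), tsub_pos_of_lt hF,
    fun G hG => ?_⟩
  have hne : ⨆ ω, c2Dist ((model k).fib ω) (F.fib ω) ≠ ⊤ := (hF.trans ENNReal.ofReal_lt_top).ne
  refine lt_of_le_of_lt (iSup_le fun ω => ?_) (lt_tsub_iff_left.1 hG)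
  exact (c2Dist_triangle _ (F.fib ω) _).trans (add_le_add
    (le_iSup (fun ω => c2Dist ((model k).fib ω) (F.fib ω)) ω) (c2Dist_le_dist F G ω))

theorem abs_iteratedDerivWithin_sub_le {δ : ℝ} (hδ : 0 ≤ δ) {G : RandomMap k}
    (hG : G ∈ modelNhd k δ) (ω : Seq k) {j : ℕ} (hj : j ≤ 2) {x : ℝ} (hx : x ∈ Icc (0 : ℝ) 1) :
    |iteratedDerivWithin j (lift (modelFiber (ω 0))) (Icc 0 1) x -
      iteratedDerivWithin j (lift (G.fib ω)) (Icc 0 1) x| ≤ δ := by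
  refine (ENNReal.ofReal_le_ofReal_iff hδ).1 ?_
  refine (ofReal_iteratedDerivWithin_sub_le _ _ hj hx).trans ?_
  exact (le_iSup (fun ω => c2Dist ((model k).fib ω) (G.fib ω)) ω).trans hG.le

theorem abs_fib_sub_modelFiber_le {δ : ℝ} (hδ : 0 ≤ δ) {G : RandomMap k}
    (hG : G ∈ modelNhd k δ) (ω : Seq k) (x : I) :
    |(G.fib ω x : ℝ) - modelFiber (ω 0) x| ≤ δ := by
  have := abs_iteratedDerivWithin_sub_le hδ hG ω (j := 0) (by norm_num) x.2
  rw [iteratedDerivWithin_zero, iteratedDerivWithin_zero, lift_coe, lift_coe] at this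
  rwa [abs_sub_comm]

theorem modelFiber_derivs_zero {x : ℝ} (hx : x ∈ Icc (0 : ℝ) 1) :
    iteratedDerivWithin 1 (lift (modelFiber (0 : Fin k))) (Icc 0 1) x = cubicDeriv x ∧
    iteratedDerivWithin 2 (lift (modelFiber (0 : Fin k))) (Icc 0 1) x = 2.4 * (x - 1 / 2) :=
  (iteratedDerivWithin_of_eqOn (eqOn_lift modelFiber_zero) hasDerivAt_cubicMap
    hasDerivAt_cubicDeriv hx).2

theorem modelFiber_derivs_of_ne {a : Fin k} (ha : a ≠ 0) {x : ℝ} (hx : x ∈ Icc (0 : ℝ) 1) :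
    iteratedDerivWithin 1 (lift (modelFiber a)) (Icc 0 1) x = 0.9 ∧
    iteratedDerivWithin 2 (lift (modelFiber a)) (Icc 0 1) x = 0 :=
  (iteratedDerivWithin_of_eqOn (p₂ := fun _ => 0) (eqOn_lift (modelFiber_of_ne ha))
    hasDerivAt_affineMap (fun x => hasDerivAt_const x 0.9) hx).2

variable {G : RandomMap k}

theorem abs_fibDeriv_sub_cubicDeriv (hG : G ∈ modelNhd k 0.0001) {ω : Seq k}
    (h0 : ω 0 = 0) {x : ℝ}
    (hx : x ∈ Icc (0 : ℝ) 1) : |fibDeriv G ω x - cubicDeriv x| ≤ 0.0001 := by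
  have := abs_iteratedDerivWithin_sub_le (by norm_num) hG ω (j := 1) (by norm_num) hx
  rw [h0, (modelFiber_derivs_zero hx).1, iteratedDerivWithin_one] at this
  rwa [abs_sub_comm]

theorem abs_fibDeriv_sub_const (hG : G ∈ modelNhd k 0.0001) {ω : Seq k}
    (h0 : ω 0 ≠ 0) {x : ℝ}
    (hx : x ∈ Icc (0 : ℝ) 1) : |fibDeriv G ω x - 0.9| ≤ 0.0001 := by
  have := abs_iteratedDerivWithin_sub_le (by norm_num) hG ω (j := 1) (by norm_num) hx
  rw [(modelFiber_derivs_of_ne h0 hx).1, iteratedDerivWithin_one] at this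
  rwa [abs_sub_comm]

theorem abs_fibDeriv_mem (hG : G ∈ modelNhd k 0.0001) (ω : Seq k) {x : ℝ} (hx : x ∈ Icc (0 : ℝ) 1) :
    |fibDeriv G ω x| ∈ Icc (0.75 : ℝ) 1.1 := by
  by_cases h0 : ω 0 = 0
  · have h1 := abs_le.1 (abs_fibDeriv_sub_cubicDeriv hG h0 hx)
    have h2 := cubicDeriv_mem hx
    rw [abs_of_nonpos (by linarith [h1.2, h2.2])]
    constructor <;> linarith [h1.1, h1.2, h2.1, h2.2]
  · have h1 := abs_le.1 (abs_fibDeriv_sub_const hG h0 hx)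
    rw [abs_of_nonneg (by linarith [h1.1])]
    constructor <;> linarith [h1.1, h1.2]

/-- Closeness of second derivatives enters here: those of the model are at most 1.2 in absolute
value on the unit interval. -/
theorem abs_fibDeriv_sub_le (hG : G ∈ modelNhd k 0.0001) (ω : Seq k) {x y : ℝ}
    (hx : x ∈ Icc (0 : ℝ) 1)
    (hy : y ∈ Icc (0 : ℝ) 1) : |fibDeriv G ω x - fibDeriv G ω y| ≤ 1.3 * |x - y| := by
  have hu := uniqueDiffOn_Icc (zero_lt_one (α := ℝ))
  have hc := (G.diffeo ω).contDiffOn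
  have hd : DifferentiableOn ℝ (fibDeriv G ω) (Icc 0 1) :=
    ((hc.derivWithin hu (m := 1) (by norm_num)).differentiableOn (by norm_num))
  refine Convex.norm_image_sub_le_of_norm_derivWithin_le hd (fun z hz => ?_) (convex_Icc 0 1) hy hx
  have h2 : derivWithin (fibDeriv G ω) (Icc 0 1) z =
      iteratedDerivWithin 2 (lift (G.fib ω)) (Icc 0 1) z := by
    rw [iteratedDerivWithin_succ]
    refine derivWithin_congr (fun w hw => ?_) ?_ <;> rw [iteratedDerivWithin_one] <;> rfl
  have h3 := abs_iteratedDerivWithin_sub_le (by norm_num) hG ω (j := 2) le_rfl hz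
  rw [h2, Real.norm_eq_abs]
  rw [abs_le] at h3 ⊢
  by_cases h0 : ω 0 = 0
  · rw [h0, (modelFiber_derivs_zero hz).2] at h3
    constructor <;> linarith [h3.1, h3.2, hz.1, hz.2]
  · rw [(modelFiber_derivs_of_ne h0 hz).2] at h3
    constructor <;> linarith [h3.1, h3.2]

end Model

/-! ### Maps near the model: contraction on average, distortion, the blender property -/

section Near

variable {k : ℕ}

theorem abs_fib_sub_eq (G : RandomMap k) (ω : Seq k) (x y : I) :
    ∃ ξ ∈ Icc (0 : ℝ) 1, ξ ∈ uIcc (x : ℝ) y ∧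
      |(G.fib ω x : ℝ) - G.fib ω y| = |fibDeriv G ω ξ| * |(x : ℝ) - y| := by
  obtain ⟨ξ, hξ, he⟩ := exists_fibDeriv_eq G ω x y
  exact ⟨ξ, uIcc_subset_Icc x.2 y.2 hξ, hξ, by rw [he, abs_mul]⟩

variable [NeZero k] {G : RandomMap k}

theorem modelNhd_mono {δ δ' : ℝ} (h : δ ≤ δ') : modelNhd k δ ⊆ modelNhd k δ' := fun _ hG =>
  lt_of_lt_of_le hG (ENNReal.ofReal_le_ofReal h)

/-- Lipschitz constants of the fiber maps near the model. -/
def nearLip (a : Fin k) : ℝ := if a = 0 then 1.082 else 0.901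

theorem nearLip_pos (a : Fin k) : 0 < nearLip a := by
  unfold nearLip; split_ifs <;> norm_num

theorem nearLip_of_ne {a : Fin k} (h : a ≠ 0) : nearLip a = 0.901 := if_neg h

/-- Only the symbol `0` may expand, and 1.082 · 0.901 < 1, so a single other symbol compensates for
it. -/
theorem sum_log_nearLip_neg {b : Fin k} (hb : b ≠ 0) : ∑ a : Fin k, Real.log (nearLip a) < 0 := by
  rw [← Finset.add_sum_erase _ _ (Finset.mem_univ (0 : Fin k)),
    ← Finset.add_sum_erase _ _ (Finset.mem_erase.2 ⟨hb, Finset.mem_univ b⟩), ← add_assoc]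
  have h1 : Real.log (nearLip (0 : Fin k)) + Real.log (nearLip b) < 0 := by
    rw [← Real.log_mul (nearLip_pos _).ne' (nearLip_pos _).ne']
    refine Real.log_neg (mul_pos (nearLip_pos _) (nearLip_pos _)) ?_
    norm_num [nearLip, hb]
  refine add_neg_of_neg_of_nonpos h1 (Finset.sum_nonpos fun a ha => ?_)
  rw [nearLip_of_ne (Finset.ne_of_mem_erase (Finset.mem_of_mem_erase ha))]
  exact Real.log_nonpos (by norm_num) (by norm_num)

theorem lipBound_of_mem (hG : G ∈ modelNhd k 0.0001) : G.LipBound nearLip := by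
  intro ω x y
  obtain ⟨ξ, hξ, -, he⟩ := abs_fib_sub_eq G ω x y
  rw [he]
  refine mul_le_mul_of_nonneg_right ?_ (abs_nonneg _)
  by_cases h0 : ω 0 = 0
  · have h1 := abs_le.1 (abs_fibDeriv_sub_cubicDeriv hG h0 hξ)
    have h2 := cubicDeriv_mem hξ
    rw [h0, nearLip, if_pos rfl, abs_le]
    constructor <;> linarith [h1.1, h1.2, h2.1, h2.2]
  · have h1 := abs_le.1 (abs_fibDeriv_sub_const hG h0 hξ)
    rw [nearLip_of_ne h0, abs_le]
    constructor <;> linarith [h1.1, h1.2]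

theorem abs_log_sub_log_le {a b c : ℝ} (hc : 0 < c) (ha : c ≤ a) (hb : c ≤ b) :
    |Real.log a - Real.log b| ≤ |a - b| / c := by
  have key : ∀ a b : ℝ, c ≤ a → c ≤ b → Real.log a - Real.log b ≤ |a - b| / c := by
    intro a b ha hb
    have hb0 : 0 < b := hc.trans_le hb
    rw [← Real.log_div (hc.trans_le ha).ne' hb0.ne']
    have h1 := Real.log_le_sub_one_of_pos (div_pos (hc.trans_le ha) hb0)
    have h2 : a / b - 1 = (a - b) / b := by field_simp
    rw [h2] at h1
    calc Real.log (a / b) ≤ (a - b) / b := h1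
      _ ≤ |a - b| / b := div_le_div_of_nonneg_right (le_abs_self _) hb0.le
      _ ≤ |a - b| / c := div_le_div_of_nonneg_left (abs_nonneg _) hc hb
  rw [abs_le]
  have h1 := key a b ha hb
  have h2 := key b a hb ha
  rw [abs_sub_comm] at h2
  constructor <;> linarith

/-- By the mean value theorem a difference quotient is a derivative at an intermediate point.
Log-derivatives have Lipschitz constant at most 1.3/0.75 < 2. -/
theorem hasLogDeriv_of_mem (hG : G ∈ modelNhd k 0.0001) :
    G.HasLogDeriv (fun ω z => Real.log |fibDeriv G ω z|) 2 := by
  intro ω x y z r hxy hx hy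
  obtain ⟨ξ, hξ, hξxy, he⟩ := abs_fib_sub_eq G ω x y
  rw [he, mul_div_cancel_right₀ _ (RandomMap.abs_pos_of_ne hxy).ne']
  have h1 := abs_log_sub_log_le (by norm_num) (abs_fibDeriv_mem hG ω hξ).1
    (abs_fibDeriv_mem hG ω z.2).1
  have h2 := abs_abs_sub_abs_le (fibDeriv G ω ξ) (fibDeriv G ω z)
  have h3 := abs_fibDeriv_sub_le hG ω hξ z.2
  have h4 : |ξ - z| ≤ r := by
    rw [abs_le] at *
    rcases mem_uIcc.1 hξxy with h | h <;> constructor <;>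
      linarith [h.1, h.2, hx.1, hx.2, hy.1, hy.2]
  have h5 : 0 ≤ r := (abs_nonneg _).trans h4
  refine h1.trans ?_
  rw [div_le_iff₀ (by norm_num)]
  linarith

theorem abs_log_fibDeriv_le (hG : G ∈ modelNhd k 0.0001) (ω : Seq k) (z : I) :
    |Real.log (|fibDeriv G ω z|)| ≤ 1 := by
  have h := abs_fibDeriv_mem hG ω z.2
  have h1 := abs_log_sub_log_le (by norm_num : (0 : ℝ) < 0.75) h.1 (by norm_num : 0.75 ≤ (1 : ℝ))
  rw [Real.log_one, sub_zero] at h1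
  refine h1.trans ?_
  rw [div_le_one (by norm_num), abs_le]
  constructor <;> linarith [h.1, h.2]

theorem isBlender_of_mem {δ C : ℝ} (hC : 0 ≤ C) (hδ0 : 0 ≤ δ) (hδ : δ ≤ 0.0001) {s₀ : ℕ}
    (hs₀ : C * (5 / 6) ^ s₀ ≤ 0.0004) (hδs : 2 * δ ≤ 0.0004 * 0.6 ^ s₀)
    (hGδ : G ∈ modelNhd k δ) (hL : G.IsLipschitz C) : IsBlender G := by
  have hG := modelNhd_mono hδ hGδ
  have hcubic : ∀ ω : Seq k, ω 0 = 0 → ∀ x : I, |(G.fib ω x : ℝ) - cubicMap x| ≤ 0.0001 :=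
    fun ω h0 x => by
      have := abs_fib_sub_modelFiber_le (by norm_num) hG ω x
      rwa [h0, modelFiber_zero] at this
  have haffine : ∀ ω : Seq k, ω 0 ≠ 0 → ∀ x : I, |(G.fib ω x : ℝ) - affineMap x| ≤ 0.0001 :=
    fun ω h0 x => by
      have := abs_fib_sub_modelFiber_le (by norm_num) hG ω x
      rwa [modelFiber_of_ne h0] at this
  -- Away from 1/2 the cubic contracts: 1.081 − 1.2 · 0.264² is about 0.9974, which leaves room for
  -- the error 0.0001.
  have hcontr : ∀ ω : Seq k, ω 0 = 0 → ∀ x y : I, (∀ ξ ∈ uIcc (x : ℝ) y,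
      0.264 ^ 2 ≤ (ξ - 1 / 2) ^ 2) →
      |(G.fib ω x : ℝ) - G.fib ω y| ≤ 0.998 * |(x : ℝ) - y| := by
    intro ω h0 x y h
    obtain ⟨ξ, hξ, hξxy, he⟩ := abs_fib_sub_eq G ω x y
    rw [he]
    refine mul_le_mul_of_nonneg_right ?_ (abs_nonneg _)
    have h1 := abs_le.1 (abs_fibDeriv_sub_cubicDeriv hG h0 hξ)
    have h2 := (cubicDeriv_mem hξ).2
    have h3 := h ξ hξxy
    unfold cubicDeriv at h1 h2
    rw [abs_le]
    constructor <;> linarith [h1.1, h1.2]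
  have e1 : cubicMap 0.764 = 0.2219758976 := by norm_num [cubicMap]
  have e2 : cubicMap 0.236 = 0.7780241024 := by norm_num [cubicMap]
  refine ⟨fun ω x y => ?_, fun ω x => ?_, fun s ω ω' hs x => ?_, fun ω h0 x y => ?_,
    fun ω h0 x y hx hy => ?_, fun ω h0 x y hx hy => ?_, hcubic, haffine⟩
  · obtain ⟨ξ, hξ, -, he⟩ := abs_fib_sub_eq G ω x y
    rw [he]
    exact mul_le_mul_of_nonneg_right (abs_fibDeriv_mem hG ω hξ).1 (abs_nonneg _)
  · by_cases h0 : ω 0 = 0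
    · have h1 := abs_le.1 (hcubic ω h0 x)
      have h2 := cubicMap_mem x.2
      constructor <;> linarith [h1.1, h1.2, h2.1, h2.2]
    · have h1 := abs_le.1 (haffine ω h0 x)
      have h2 := affineMap_mem x.2
      constructor <;> linarith [h1.1, h1.2, h2.1, h2.2]
  -- For short agreement, both fiber maps are δ-close to the same model map and 2δ is small against
  -- 0.6^s₀. For long agreement the Lipschitz condition gives a bound C (1/2)^s, written as C
  -- (5/6)^s · 0.6^s.
  · rcases le_total s s₀ with hle | hle
    · have h1 := abs_le.1 (abs_fib_sub_modelFiber_le hδ0 hGδ ω x)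
      have h2 := abs_le.1 (abs_fib_sub_modelFiber_le hδ0 hGδ ω' x)
      rw [hs 0 (by omega)] at h1
      have h3 : (0.6 : ℝ) ^ s₀ ≤ 0.6 ^ s :=
        pow_le_pow_of_le_one (by norm_num) (by norm_num) hle
      rw [abs_le]
      constructor <;> linarith [h1.1, h1.2, h2.1, h2.2]
    · have h1 : seqDist ω ω' ≤ (1 / 2) ^ (s + 1) := seqDist_le fun i hi => hs i (by omega)
      have h2 : |(G.fib ω x : ℝ) - G.fib ω' x| ≤ C * (1 / 2) ^ (s + 1) :=
        (ENNReal.ofReal_le_ofReal_iff (by positivity)).1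
          (((ofReal_abs_sub_le_c2Dist _ _ x).trans (hL ω ω')).trans
            (ENNReal.ofReal_le_ofReal (mul_le_mul_of_nonneg_left h1 hC)))
      have h3 : ((1 : ℝ) / 2) ^ s = (5 / 6) ^ s * 0.6 ^ s := by
        rw [← mul_pow]; norm_num
      have h4 : (5 / 6 : ℝ) ^ s ≤ (5 / 6) ^ s₀ :=
        pow_le_pow_of_le_one (by norm_num) (by norm_num) hle
      have h5 : ((1 : ℝ) / 2) ^ (s + 1) ≤ (1 / 2) ^ s :=
        pow_le_pow_of_le_one (by norm_num) (by norm_num) (Nat.le_succ s)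
      calc |(G.fib ω x : ℝ) - G.fib ω' x| ≤ C * (1 / 2) ^ (s + 1) := h2
        _ ≤ C * ((5 / 6) ^ s * 0.6 ^ s) :=
          mul_le_mul_of_nonneg_left (h5.trans h3.le) hC
        _ = C * (5 / 6) ^ s * 0.6 ^ s := by ring
        _ ≤ 0.0004 * 0.6 ^ s := mul_le_mul_of_nonneg_right
          ((mul_le_mul_of_nonneg_left h4 hC).trans hs₀) (by positivity)
  · refine (lipBound_of_mem hG ω x y).trans (mul_le_mul_of_nonneg_right ?_ (abs_nonneg _))
    rw [nearLip_of_ne h0]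
    norm_num
  · have key : ∀ x : I, (G.fib ω x : ℝ) ≤ 0.215 → 0.764 ≤ (x : ℝ) := fun x hx => by
      by_contra hlt
      have h1 := cubicMap_antitoneOn x.2 (by norm_num : (0.764 : ℝ) ∈ Icc (0 : ℝ) 1)
        (not_le.1 hlt).le
      linarith [(abs_le.1 (hcubic ω h0 x)).1]
    refine hcontr ω h0 x y fun ξ hξ => ?_
    have h1 : (0.764 : ℝ) ≤ ξ := (le_min (key x hx) (key y hy)).trans hξ.1
    nlinarith
  · have key : ∀ x : I, 0.785 ≤ (G.fib ω x : ℝ) → (x : ℝ) ≤ 0.236 := fun x hx => by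
      by_contra hlt
      have h1 := cubicMap_antitoneOn (by norm_num : (0.236 : ℝ) ∈ Icc (0 : ℝ) 1) x.2
        (not_le.1 hlt).le
      linarith [(abs_le.1 (hcubic ω h0 x)).2]
    refine hcontr ω h0 x y fun ξ hξ => ?_
    have h1 : ξ ≤ 0.236 := hξ.2.trans (max_le (key x hx) (key y hy))
    nlinarith

/-- Fiber maps of the model can differ only when the symbols at index 0 do, and then the base points
are at distance 1. It remains to bound the C² distance of the two model maps by 2, which is the
source of C₀. -/
theorem isLipschitz_model {C : ℝ} (hC : 2 ≤ C) : (model k).IsLipschitz C := by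
  intro ω ω'
  by_cases h : ω 0 = ω' 0
  · have : (model k).fib ω = (model k).fib ω' := congrArg modelFiber h
    rw [this, c2Dist_self]
    exact bot_le
  · have hd : seqDist ω ω' = 1 := by
      have hne : ω ≠ ω' := fun he => h (by rw [he])
      have hz : sInf {m : ℕ | ∃ n : ℤ, n.natAbs = m ∧ ω n ≠ ω' n} = 0 :=
        Nat.sInf_eq_zero.2 (Or.inl ⟨0, rfl, h⟩)
      rw [seqDist, if_neg hne, hz, pow_zero]
    rw [hd, mul_one]
    have key : ∀ b : Fin k, b ≠ 0 → ∀ x ∈ Icc (0 : ℝ) 1, ∀ j ≤ 2,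
        |iteratedDerivWithin j (lift (modelFiber (0 : Fin k))) (Icc 0 1) x -
          iteratedDerivWithin j (lift (modelFiber b)) (Icc 0 1) x| ≤ 2 := by
      intro b hb x hx j hj
      interval_cases j
      · rw [iteratedDerivWithin_zero, iteratedDerivWithin_zero, eqOn_lift modelFiber_zero hx,
          eqOn_lift (modelFiber_of_ne hb) hx, abs_le]
        have h1 := cubicMap_mem hx
        have h2 := affineMap_mem hx
        constructor <;> linarith [h1.1, h1.2, h2.1, h2.2]
      · rw [(modelFiber_derivs_zero hx).1, (modelFiber_derivs_of_ne hb hx).1, abs_le]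
        have h1 := cubicDeriv_mem hx
        constructor <;> linarith [h1.1, h1.2]
      · rw [(modelFiber_derivs_zero hx).2, (modelFiber_derivs_of_ne hb hx).2, abs_le]
        constructor <;> linarith [hx.1, hx.2]
    refine iSup₂_le fun x hx => iSup₂_le fun j hj => ENNReal.ofReal_le_ofReal ?_
    change |iteratedDerivWithin j (lift (modelFiber (ω 0))) (Icc 0 1) x -
      iteratedDerivWithin j (lift (modelFiber (ω' 0))) (Icc 0 1) x| ≤ C
    refine le_trans ?_ hC
    by_cases h0 : ω 0 = 0
    · rw [h0]
      exact key _ (fun h' => h (by rw [h0, h'])) x hx j hj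
    · by_cases h0' : ω' 0 = 0
      · rw [h0', abs_sub_comm]
        exact key _ h0 x hx j hj
      · cases j with
        | zero =>
          rw [iteratedDerivWithin_zero, iteratedDerivWithin_zero,
            eqOn_lift (modelFiber_of_ne h0) hx, eqOn_lift (modelFiber_of_ne h0') hx]
          simp
        | succ j =>
          have hj' : j + 1 ≤ 2 := hj
          have : j ≤ 1 := by omega
          interval_cases j
          · rw [(modelFiber_derivs_of_ne h0 hx).1, (modelFiber_derivs_of_ne h0' hx).1]
            simp
          · rw [(modelFiber_derivs_of_ne h0 hx).2, (modelFiber_derivs_of_ne h0' hx).2]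
            simp

/-- Over the constant sequence `0`, the maximal attractor of the model contains the attracting
cycle of period two of `cubicMap`. -/
theorem const_zero_notMem_pointSet : (fun _ => (0 : Fin k)) ∉ (model k).pointSet := by
  -- The 2-cycle 1/2 ± 0.45 solves 1.081 t − 0.4 t³ = t, that is 0.4 t² = 0.081; hence the
  -- coefficient 1.081.
  set a : I := ⟨0.05, by norm_num, by norm_num⟩ with ha
  set b : I := ⟨0.95, by norm_num, by norm_num⟩ with hb
  have hab : (model k).fib (fun _ => 0) a = b := by
    refine Subtype.ext ((modelFiber_zero (k := k) a).trans ?_)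
    norm_num [cubicMap, ha, hb]
  have hba : (model k).fib (fun _ => 0) b = a := by
    refine Subtype.ext ((modelFiber_zero (k := k) b).trans ?_)
    norm_num [cubicMap, ha, hb]
  have hshift : shift (fun _ => (0 : Fin k)) = fun _ => 0 := rfl
  have key : ∀ n : ℕ, a ∈ range ((model k).fibIter n fun _ => 0) ∧
      b ∈ range ((model k).fibIter n fun _ => 0) := by
    have : ∀ n : ℕ, ({a, b} : Set I) ⊆ (model k).fibIter n (fun _ => 0) '' {a, b} := by
      intro n
      induction n with
      | zero => exact fun x hx => ⟨x, hx, rfl⟩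
      | succ n ih =>
        intro x hx
        obtain ⟨y, hy, rfl⟩ := ih hx
        rcases hy with rfl | rfl
        · exact ⟨b, Or.inr rfl, by rw [RandomMap.fibIter_succ, hba, hshift]⟩
        · exact ⟨a, Or.inl rfl, by rw [RandomMap.fibIter_succ, hab, hshift]⟩
    exact fun n => ⟨image_subset_range _ _ (this n (Or.inl rfl)),
      image_subset_range _ _ (this n (Or.inr rfl))⟩
  intro hsub
  have h1 : a ∈ (model k).sec fun _ => 0 := (model k).mem_sec_iff.2 fun n => (key n).1
  have h2 : b ∈ (model k).sec fun _ => 0 := (model k).mem_sec_iff.2 fun n => (key n).2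
  have h3 : (a : ℝ) = b := congrArg Subtype.val (hsub h1 h2)
  norm_num [ha, hb] at h3

end Near

end BonyAttractor

end

/-! ### The main theorem -/

theorem theoremA (k : ℕ) [NeZero k] (hk : 2 ≤ k) :
    ∃ C₀ : ℝ, 0 < C₀ ∧ ∀ C : ℝ, C₀ ≤ C →
      ∃ (U : Set (BonyAttractor.RandomMap k))
        (Ω : BonyAttractor.RandomMap k → Set (BonyAttractor.Seq k))
        (γ : BonyAttractor.RandomMap k → BonyAttractor.Seq k → unitInterval)
        (μ : BonyAttractor.RandomMap k →
          MeasureTheory.Measure (BonyAttractor.Seq k × unitInterval)),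
        U.Nonempty ∧ BonyAttractor.IsOpenC2 U ∧
        (∀ G ∈ U,
          -- the invariant graph, over a set of full measure
          (MeasurableSet (Ω G) ∧ (∀ᵐ ω ∂BonyAttractor.bernoulliMeasure k, ω ∈ Ω G) ∧
            ContinuousOn (γ G) (Ω G) ∧
            G.toMap '' BonyAttractor.graphOver (Ω G) (γ G) =
              BonyAttractor.graphOver (Ω G) (γ G)) ∧
          -- the maximal attractor
          (G.IsLipschitz C →
            BonyAttractor.IsContinuousGraph (Ω G) (γ G) G.maxAttractor ∨
            BonyAttractor.IsBonyGraph (Ω G) (γ G) G.maxAttractor) ∧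
          -- the invariant measure
          (MeasureTheory.IsProbabilityMeasure (μ G) ∧ Ergodic G.toMap (μ G) ∧
            MeasureTheory.MeasurePreserving Prod.fst (μ G) (BonyAttractor.bernoulliMeasure k) ∧
            (∀ᵐ z ∂μ G, z ∈ BonyAttractor.graphOver (Ω G) (γ G)) ∧
            (μ G).support = closure (BonyAttractor.graphOver (Ω G) (γ G)) ∧
            BonyAttractor.IsBernoulli G.toMap (μ G) ∧
            BonyAttractor.IsMixing G.toMap (μ G)) ∧
          -- continuity of the invariant measure in the Hutchinson metric
          (∀ ε : ENNReal, 0 < ε → ∃ δ : ENNReal, 0 < δ ∧ ∀ H ∈ U, G.dist H < δ →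
            BonyAttractor.hutchinsonDist (μ H) (μ G) < ε) ∧
          -- the fiber Lyapunov exponent
          (∃ lam : ℝ, lam < 0 ∧ G.HasFiberExponent lam)) ∧
        -- some maximal attractor is bony
        (∃ G ∈ U, G.IsLipschitz C ∧
          BonyAttractor.IsBonyGraph (Ω G) (γ G) G.maxAttractor) := by
  open BonyAttractor in
  refine ⟨2, two_pos, fun C hC => ?_⟩
  have hC0 : 0 < C := lt_of_lt_of_le two_pos hC
  obtain ⟨b, hb0⟩ : ∃ b : Fin k, b ≠ 0 :=
    ⟨⟨1, by omega⟩, fun h => by simpa using congrArg Fin.val h⟩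
  -- `s₀` is the memory length beyond which the `C`-Lipschitz condition alone suffices; δ is then
  -- taken small against 0.6^s₀. The open set therefore depends on `C`.
  obtain ⟨s₀, hs₀⟩ := exists_pow_lt_of_lt_one (div_pos (by norm_num : (0 : ℝ) < 0.0004) hC0)
    (by norm_num : (5 / 6 : ℝ) < 1)
  rw [lt_div_iff₀ hC0, mul_comm] at hs₀
  have hpow : (0 : ℝ) < 0.6 ^ s₀ := by positivity
  obtain ⟨δ, hδ0, hδ, hδs⟩ : ∃ δ : ℝ, 0 < δ ∧ δ ≤ 0.0001 ∧ 2 * δ ≤ 0.0004 * 0.6 ^ s₀ :=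
    ⟨min 0.0001 (0.0002 * 0.6 ^ s₀), lt_min (by norm_num) (by positivity), min_le_left _ _,
      by linarith [min_le_right (0.0001 : ℝ) (0.0002 * 0.6 ^ s₀)]⟩
  have hneg := sum_log_nearLip_neg hb0
  have hpos : ∀ a : Fin k, 0 < nearLip a := nearLip_pos
  have hb1 : nearLip b < 1 := by rw [nearLip_of_ne hb0]; norm_num
  have hlip : ∀ G ∈ modelNhd k δ, G.LipBound nearLip := fun G hG =>
    lipBound_of_mem (modelNhd_mono hδ hG)
  have hae : ∀ G ∈ modelNhd k δ, ∀ᵐ ω ∂bernoulliMeasure k, ω ∈ G.pointSet := fun G hG =>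
    (hlip G hG).ae_mem_pointSet hpos hneg
  have hattr : ∀ G ∈ modelNhd k δ, G.IsLipschitz C →
      IsContinuousGraph G.pointSet G.lowerPoint G.maxAttractor ∨
        IsBonyGraph G.pointSet G.lowerPoint G.maxAttractor := fun G hG hGC =>
    G.continuousGraph_or_bonyGraph (hae G hG) fun ω hω x hx =>
      (isBlender_of_mem hC0.le hδ0.le hδ hs₀.le hδs hG hGC).bone_subset_closure (hlip G hG) hpos
        hb0 hb1 hω hx
  refine ⟨modelNhd k δ, RandomMap.pointSet, RandomMap.lowerPoint, fun G => G.graphMeasure,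
    ⟨_, model_mem_modelNhd hδ0⟩, isOpenC2_modelNhd δ, fun G hG => ⟨⟨G.measurableSet_pointSet,
      hae G hG, G.continuousOn_lowerPoint, G.image_graph⟩, hattr G hG, ⟨inferInstance,
      (RandomMap.isMixing_graphMeasure (hae G hG)).ergodic, G.measurePreserving_fst_graphMeasure,
      RandomMap.ae_mem_graph (hae G hG), RandomMap.support_graphMeasure (hae G hG),
      RandomMap.isBernoulli_graphMeasure (hae G hG), RandomMap.isMixing_graphMeasure (hae G hG)⟩,
      fun ε hε => ?_, ?_⟩, model k, model_mem_modelNhd hδ0, isLipschitz_model hC, ?_⟩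
  · obtain ⟨η, hη, h⟩ := (hlip G hG).hutchinson_continuity hpos hneg hε
    exact ⟨η, hη, fun H _ hH => h H hH⟩
  · have hG' := modelNhd_mono hδ hG
    exact (hasLogDeriv_of_mem hG').exists_exponent (by norm_num) (hlip G hG) hpos hneg
      (abs_log_fibDeriv_le hG')
  · refine (hattr _ (model_mem_modelNhd hδ0) (isLipschitz_model hC)).resolve_left fun h => ?_
    exact const_zero_notMem_pointSet (h.1 ▸ mem_univ _)
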